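/- Let $\mathfrak X$ be a finite alphabet, $p_X$ a probability distribution on $\mathfrak X$, $p_S$ a probability distribution on $\{0,\dots,s_{\max}\}$, and $p_{Y|X}$ a noise channel from $\mathfrak X$ to $\mathfrak X$. Let the unlabeled database $\mathbf D^{(1)}$ be an $m_n\times n$ matrix with i.i.d. entries drawn from $p_X$ ($m_n\ge 1$), let $S^n=(S_1,\dots,S_n)$ be i.i.d. with law $p_S$, and let $\boldsymbol\Theta_n$ be a uniform permutation of $[m_n]$, all independent. The $i$-th row of the labeled database $\mathbf D^{(2)}$ is the concatenation over $j=1,\dots,n$, without separators, of words of $S_j$ outputs of $p_{Y|X}$ on the entry $D^{(1)}_{\boldsymbol\Theta_n^{-1}(i),j}$, all outputs being conditionally independent (the word is empty if $S_j=0$). In addition, $B_n$ seeds are available: a pair $(\mathbf G^{(1)},\mathbf G^{(2)})$ of matrices of $B_n$ further, correctly matched row pairs that are generated in the same way with the same $S^n$ and are, given $S^n$, independent of $(\mathbf D^{(1)},\mathbf D^{(2)},\boldsymbol\Theta_n)$. The seed order is $d$ if $B_n=\Theta(n^d)$. A matching scheme is a sequence of maps $\phi_n:(\mathbf D^{(1)},\mathbf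 D^{(2)},\mathbf G^{(1)},\mathbf G^{(2)})\mapsto\hat{\boldsymbol\Theta}_n$ with $\hat{\boldsymbol\Theta}_n:[m_n]\to[m_n]$; it is successful if $\Pr(\boldsymbol\Theta_n(J)\ne\hat{\boldsymbol\Theta}_n(J))\to0$ as $n\to\infty$, where $J$ is uniform on $[m_n]$ and independent of everything else. The database growth rate is $R=\lim_{n\to\infty}\frac1n\log_2 m_n$. A rate $R$ is achievable for the seed order $d$ if, for some row sizes $m_n$ of growth rate $R$ and some seed sizes $B_n$ of order $d$, there is a successful matching scheme. The matching capacity $C(d)$ is the supremum of the achievable rates. Theorem. For every seed order $d\ge1$, $$C(d)=I(X;Y^S,S)\quad\text{(in bits)},$$ where $X\sim p_X$ and $S\sim p_S$ are independent and $Y^S=Y_1,\dots,Y_S$ with $\Pr(Y^S=y_1,\dots,y_s\mid X=x,S=s)=\prod_{i=1}^{s}p_{Y|X}(y_i|x)$. Moreover, if $R<I(X;Y^S,S)$ and $d\ge1$, then a successful matching scheme exists for all row sizes $m_n$ of growth rate $R$ and all seed sizes $B_n=\Theta(n^d)$. Conversely, for arbitrary seed sizes $B_n$ (in particular for any seed order),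 whenever a successful matching scheme exists for row sizes of growth rate $R$, one has $R\le I(X;Y^S,S)$. -/

import Mathlib

open Filter Topology Asymptotics

noncomputable section

namespace DatabaseMatching

/-- The mutual information, in bits, of a pair of finitely valued random variables with joint
probability mass function `P`.  (A term with `P a b = 0` vanishes, as usual, and both marginals
are positive where `P a b` is.) -/
def mutualInfo {α β : Type*} [Fintype α] [Fintype β] (P : α → β → ℝ) : ℝ :=
  ∑ a, ∑ b, P a b * Real.logb 2 (P a b / ((∑ b', P a b') * (∑ a', P a' b)))

section Model

variable {A : Type*} {s : ℕ}

/-- The joint probability mass function of `X` and `(S, Y^S)`: `X ∼ pX` and `S ∼ pS` are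
independent and, given them, `Y^S` is a word of `S` i.i.d. outputs of the channel `W` with
input `X` (the empty word for `S = 0`).  The repetition number lies in `{0, …, s}`. -/
def jointMass (pX : PMF A) (pS : PMF (Fin (s + 1))) (W : A → PMF A)
    (x : A) (sy : Σ r : Fin (s + 1), (Fin (r : ℕ) → A)) : ℝ :=
  (pX x).toReal * (pS sy.1).toReal * ∏ l, (W x (sy.2 l)).toReal

/-- The mutual information `I(X; Y^S, S)`, in bits. -/
def repetitionInfo [Fintype A] (pX : PMF A) (pS : PMF (Fin (s + 1))) (W : A → PMF A) : ℝ :=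
  mutualInfo (jointMass pX pS W)

/-- The row of the noisy repeated database that is obtained with the repetition pattern `S`:
`z j` lists `s` noisy copies of the `j`-th entry of the original row, of which the first `S j`
are kept (none, if the column is deleted); the surviving words are concatenated without
any marker between them. -/
def repeatRow {n : ℕ} (S : Fin n → Fin (s + 1)) (z : Fin n → Fin s → A) : List A :=
  (List.ofFn fun j => (List.ofFn (z j)).take (S j : ℕ)).flatten

/-- The probability that an `r × n` database with i.i.d. entries `∼ pX` equals `x` and that
the noisy copies of its entries, each an independent output of the channel `W` on that entry,
are given by `z`. -/
def dataMass (pX : PMF A) (W : A → PMF A) {r n : ℕ}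
    (x : Fin r → Fin n → A) (z : Fin r → Fin n → Fin s → A) : ℝ :=
  ∏ i, ∏ j, ((pX (x i j)).toReal * ∏ l, (W (x i j) (z i j l)).toReal)

/-- The probability that the column repetition pattern, with i.i.d. entries `∼ pS`, is `S`. -/
def patternMass (pS : PMF (Fin (s + 1))) {n : ℕ} (S : Fin n → Fin (s + 1)) : ℝ :=
  ∏ j, (pS (S j)).toReal

/-- The matching maps for `m` rows, `B` seeds and `n` columns.  The arguments are the unlabeled
database `D₁`, the rows of the labeled noisy repeated database `D₂` and the two seed matrices
`G₁`, `G₂`; the value is the estimate of the labeling function. -/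
abbrev MatchingMap (A : Type*) (m B n : ℕ) : Type _ :=
  (Fin m → Fin n → A) → (Fin m → List A) → (Fin B → Fin n → A) → (Fin B → List A) →
    (Fin m → Fin m)

/-- The probability `Pr(Θ(J) ≠ Θ̂(J))` that the matching map `φ` errs on a row.
Here `S` is the repetition pattern, `Θ` the uniform labeling permutation of the `m` rows, `x` the
unlabeled database with noisy copies `z`, and `xG`, `zG` are the `B` seed rows with their
noisy copies, all independent but for the dependence of `z` on `x` and of `zG` on `xG`; `J` is
a uniform row index independent of everything.  Row `i` of the labeled database is the noisy
repeated version of row `Θ⁻¹ i` of the unlabeled one; the seed pairs are correctly matched and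
are subject to the same repetition pattern `S`. -/
def errorProb [Fintype A] (pX : PMF A) (pS : PMF (Fin (s + 1))) (W : A → PMF A) {m B n : ℕ}
    (φ : MatchingMap A m B n) : ℝ :=
  ∑ S : Fin n → Fin (s + 1), ∑ Θ : Equiv.Perm (Fin m),
    ∑ x : Fin m → Fin n → A, ∑ z : Fin m → Fin n → Fin s → A,
      ∑ xG : Fin B → Fin n → A, ∑ zG : Fin B → Fin n → Fin s → A, ∑ J : Fin m,
        patternMass pS S * (1 / (Nat.factorial m : ℝ)) * dataMass pX W x z *
          dataMass pX W xG zG * (1 / (m : ℝ)) *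
          (if Θ J ≠ φ x (fun i => repeatRow S (z (Θ.symm i))) xG
              (fun b => repeatRow S (zG b)) J
            then 1 else 0)

/-- The matching scheme `φ` is successful: its error probability tends to `0` as the number `n`
of columns grows, with `m n` rows and `B n` seeds. -/
def Successful [Fintype A] (pX : PMF A) (pS : PMF (Fin (s + 1))) (W : A → PMF A) (m B : ℕ → ℕ)
    (φ : ∀ n, MatchingMap A (m n) (B n) n) : Prop :=
  Tendsto (fun n => errorProb pX pS W (φ n)) atTop (𝓝 0)

/-- The (positive) numbers of rows `m n` have growth rate `R = lim (log₂ (m n)) / n`. -/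
def HasGrowthRate (m : ℕ → ℕ) (R : ℝ) : Prop :=
  (∀ n, 0 < m n) ∧ Tendsto (fun n : ℕ => Real.logb 2 (m n : ℝ) / (n : ℝ)) atTop (𝓝 R)

/-- The seed sizes `B n` have seed order `d`, that is, `B n = Θ(n ^ d)`. -/
def HasSeedOrder (B : ℕ → ℕ) (d : ℝ) : Prop :=
  (fun n : ℕ => (B n : ℝ)) =Θ[atTop] (fun n : ℕ => (n : ℝ) ^ d)

/-- The growth rate `R` is achievable for the seed order `d`. -/
def Achievable [Fintype A] (pX : PMF A) (pS : PMF (Fin (s + 1))) (W : A → PMF A)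
    (d R : ℝ) : Prop :=
  ∃ m B : ℕ → ℕ, HasGrowthRate m R ∧ HasSeedOrder B d ∧
    ∃ φ : ∀ n, MatchingMap A (m n) (B n) n, Successful pX pS W m B φ

/-- `C` is the matching capacity for the seed order `d`: the supremum of the achievable
growth rates (which is thereby asserted to exist). -/
def IsMatchingCapacity [Fintype A] (pX : PMF A) (pS : PMF (Fin (s + 1))) (W : A → PMF A)
    (d C : ℝ) : Prop :=
  IsLUB {R : ℝ | Achievable pX pS W d R} C

end Model

end DatabaseMatching

end

/-! Everything rests on the likelihood ratio of a row and a labeled row whose pattern `S` is known.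
For a correct pair its logarithm is a sum of `n` i.i.d. terms of mean `I(X; Y^S, S) * log 2`
(`repetitionInfo_mul_log_two`); for unrelated rows the ratio itself has mean at most 1.

Converse: freeze `S` and the seeds, which given `S` say nothing about the databases. Dividing by the
likelihood ratio `L` of the whole database makes `Θ` independent of the data, and then the number
`N` of correct matches has exponential moments at most those of a Poisson variable of mean 1
(`sum_perm_pow_card_agree_le`). So `m ^ N / L` has mean at most `exp (m - 1)`, and `log u ≤ u - 1`
bounds the mean of `N * log m` by that of `log L` plus `m`. Since `log L` has mean `m * n * I * log
2`, division by `m * n` gives the claim, uniformly in the number of seeds.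

Achievability: if `I > 0`, an entry and one noisy copy of it are dependent, so their Bhattacharyya
coefficient `ρ` is below 1. A likelihood ratio test decides whether a column of labeled seeds comes
from a given column of unlabeled ones, with error at most `ρ ^ B`. There are only `n * n * s` such
tests, so linearly many seeds reveal `S` (`Separates.pattern_eq`, `not_separates_le`). Then rows are
matched by thresholding the likelihood ratio at `exp (n * γ)` with `R * log 2 < γ < I * log 2`:
Chernoff's bound shows that the true row passes, and Markov's inequality with a union bound over the
rows excludes the others. -/

noncomputable section

namespace DatabaseMatching

/-! ### Finite probability: means, product laws, Chernoff's bound, random permutations -/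

section FiniteProbability

variable {α β ι : Type*} [Fintype α] [Fintype β] [Fintype ι]

/-- The mean of `F` under the mass function `p`. -/
def mean (p F : α → ℝ) : ℝ := ∑ a, p a * F a

/-- The product mass function. -/
def piMass (p : α → ℝ) (c : ι → α) : ℝ := ∏ k, p (c k)

/-- Comparison is required only on the support, where the likelihood ratios met later are positive.
-/
theorem mean_mono {p : α → ℝ} (hp : p ∈ stdSimplex ℝ α) {F G : α → ℝ}
    (h : ∀ a, 0 < p a → F a ≤ G a) : mean p F ≤ mean p G := by
  refine Finset.sum_le_sum fun a _ => ?_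
  rcases (hp.1 a).eq_or_lt with h0 | h0
  · simp [← h0]
  · exact mul_le_mul_of_nonneg_left (h a h0) h0.le

theorem mean_congr {p : α → ℝ} (hp : p ∈ stdSimplex ℝ α) {F G : α → ℝ}
    (h : ∀ a, 0 < p a → F a = G a) : mean p F = mean p G :=
  le_antisymm (mean_mono hp fun a ha => (h a ha).le) (mean_mono hp fun a ha => (h a ha).ge)

theorem mean_const {p : α → ℝ} (hp : p ∈ stdSimplex ℝ α) (r : ℝ) :
    mean p (fun _ => r) = r := by
  rw [mean, ← Finset.sum_mul, hp.2, one_mul]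

theorem mean_nonneg {p : α → ℝ} (hp : p ∈ stdSimplex ℝ α) {F : α → ℝ}
    (h : ∀ a, 0 ≤ F a) : 0 ≤ mean p F :=
  Finset.sum_nonneg fun a _ => mul_nonneg (hp.1 a) (h a)

theorem mean_add (p F G : α → ℝ) : mean p (fun a => F a + G a) = mean p F + mean p G := by
  simp [mean, mul_add, Finset.sum_add_distrib]

theorem mean_sub (p F G : α → ℝ) : mean p (fun a => F a - G a) = mean p F - mean p G := by
  simp [mean, mul_sub, Finset.sum_sub_distrib]

theorem mean_const_mul (p F : α → ℝ) (r : ℝ) : mean p (fun a => r * F a) = r * mean p F := by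
  simp only [mean, Finset.mul_sum]
  exact Finset.sum_congr rfl fun a _ => by ring

theorem mean_mul_const (p F : α → ℝ) (r : ℝ) : mean p (fun a => F a * r) = mean p F * r := by
  simp only [mean, Finset.sum_mul, mul_assoc]

theorem mean_sum {κ : Type*} (t : Finset κ) (p : α → ℝ) (F : κ → α → ℝ) :
    mean p (fun a => ∑ k ∈ t, F k a) = ∑ k ∈ t, mean p (F k) := by
  simp only [mean, Finset.mul_sum]
  exact Finset.sum_comm

theorem mean_comm (p : α → ℝ) (q : β → ℝ) (F : α → β → ℝ) :
    mean p (fun a => mean q (F a)) = mean q (fun b => mean p fun a => F a b) := by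
  simp only [mean, Finset.mul_sum]
  rw [Finset.sum_comm]
  exact Finset.sum_congr rfl fun b _ => Finset.sum_congr rfl fun a _ => by ring

theorem piMass_mem_stdSimplex [DecidableEq ι] {p : α → ℝ} (hp : p ∈ stdSimplex ℝ α) :
    (piMass p : (ι → α) → ℝ) ∈ stdSimplex ℝ (ι → α) := by
  refine ⟨fun c => Finset.prod_nonneg fun k _ => hp.1 _, ?_⟩
  have := Finset.prod_univ_sum (fun _ : ι => (Finset.univ : Finset α)) (fun _ a => p a)
  simp only [hp.2, Finset.prod_const_one, Fintype.piFinset_univ] at this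
  exact this.symm

theorem pos_of_piMass_pos {p : α → ℝ} (hp : p ∈ stdSimplex ℝ α) {c : ι → α}
    (h : 0 < piMass p c) (k : ι) : 0 < p (c k) :=
  (hp.1 _).lt_of_ne fun h0 => h.ne' (Finset.prod_eq_zero (Finset.mem_univ k) h0.symm)

theorem mean_piMass_prod [DecidableEq ι] (p : α → ℝ) (g : ι → α → ℝ) :
    mean (piMass p) (fun c : ι → α => ∏ k, g k (c k)) = ∏ k, mean p (g k) := by
  simp only [mean, piMass, ← Finset.prod_mul_distrib, Finset.prod_univ_sum,
    Fintype.piFinset_univ]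

theorem mean_piMass_eval [DecidableEq ι] {p : α → ℝ} (hp : p ∈ stdSimplex ℝ α) (j : ι)
    (g : α → ℝ) : mean (piMass p) (fun c : ι → α => g (c j)) = mean p g := by
  have h := mean_piMass_prod p (fun k a => if k = j then g a else 1)
  have h' : ∀ k, mean p (fun a => if k = j then g a else 1) = if k = j then mean p g else 1 := by
    intro k
    split_ifs
    · rfl
    · exact mean_const hp 1
  simpa [h', Finset.prod_ite_eq'] using h

theorem mean_piMass_eval₂ [DecidableEq ι] {p : α → ℝ} (hp : p ∈ stdSimplex ℝ α) {j k : ι}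
    (hjk : j ≠ k) (g : α → α → ℝ) :
    mean (piMass p) (fun c : ι → α => g (c j) (c k)) = mean p (fun a => mean p (g a)) := by
  classical
  -- Splitting by the value of `c j` makes each summand a product over coordinates.
  have h1 : ∀ c : ι → α, g (c j) (c k) = ∑ a, (if c j = a then 1 else 0) * g a (c k) := by
    intro c
    simp
  simp only [h1]
  rw [mean_sum]
  refine Finset.sum_congr rfl fun a _ => ?_
  have h := mean_piMass_prod p (fun i b => (if i = j then (if b = a then 1 else 0) else 1) *
    (if i = k then g a b else 1))
  simp only [Finset.prod_mul_distrib, Finset.prod_ite_eq', Finset.mem_univ, if_true] at h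
  rw [h]
  have h2 : ∀ i, mean p (fun b => (if i = j then (if b = a then 1 else 0) else 1) *
      (if i = k then g a b else 1)) =
      (if i = j then p a else 1) * (if i = k then mean p (g a) else 1) := by
    intro i
    by_cases hj : i = j
    · subst hj
      simp [hjk, mean]
    · by_cases hk : i = k
      · simp [hk, mean, hjk.symm]
      · simp [hj, hk, mean_const hp]
  simp only [h2, Finset.prod_mul_distrib, Finset.prod_ite_eq', Finset.mem_univ, if_true]

theorem uniform_mem_stdSimplex [Nonempty α] :
    (fun _ : α => 1 / (Fintype.card α : ℝ)) ∈ stdSimplex ℝ α :=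
  ⟨fun _ => by positivity, by simp⟩

/-- A family of mass functions transported by maps of the coordinates. -/
theorem sum_pi_pushforward [DecidableEq ι] {Z Y : ι → Type*} [∀ k, Fintype (Z k)]
    [∀ k, Fintype (Y k)] (t : ∀ k, Z k → Y k) (w : ∀ k, Z k → ℝ) (v : ∀ k, Y k → ℝ)
    (h : ∀ k (F : Y k → ℝ), ∑ z, w k z * F (t k z) = ∑ y, v k y * F y)
    (F : (∀ k, Y k) → ℝ) :
    ∑ z : ∀ k, Z k, (∏ k, w k (z k)) * F (fun k => t k (z k)) =
      ∑ y : ∀ k, Y k, (∏ k, v k (y k)) * F y := by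
  classical
  -- Point indicators factor over the coordinates, which reduces the claim to `h` in each one.
  have h1 : ∀ z : ∀ k, Z k, F (fun k => t k (z k)) =
      ∑ y : ∀ k, Y k, (∏ k, if t k (z k) = y k then 1 else 0) * F y := by
    intro z
    have : ∀ y : ∀ k, Y k, (∏ k, if t k (z k) = y k then (1 : ℝ) else 0) =
        if (fun k => t k (z k)) = y then 1 else 0 := by
      intro y
      rw [Finset.prod_ite_zero]
      simp [funext_iff]
    simp [this]
  simp only [h1, Finset.mul_sum]
  rw [Finset.sum_comm]
  refine Finset.sum_congr rfl fun y _ => ?_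
  simp only [← mul_assoc, ← Finset.prod_mul_distrib, ← Finset.sum_mul]
  congr 1
  have h2 := (Finset.prod_univ_sum (fun k : ι => (Finset.univ : Finset (Z k)))
    (fun k z => w k z * if t k z = y k then 1 else 0)).symm
  rw [Fintype.piFinset_univ] at h2
  rw [h2]
  refine Finset.prod_congr rfl fun k _ => ?_
  rw [h k (fun y' => if y' = y k then 1 else 0)]
  simp

/-- Chernoff's bound for the lower tail has a negative exponent below the mean. -/
theorem exists_exponential_moment_lt_one {p : α → ℝ} (hp : p ∈ stdSimplex ℝ α) {l : α → ℝ}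
    {γ : ℝ} (h : γ < mean p l) :
    ∃ t : ℝ, 0 < t ∧ mean p (fun a => Real.exp (t * (γ - l a))) < 1 := by
  -- The moment equals 1 at `t = 0` and has negative derivative there, so it is below 1 for some
  -- small `t > 0`.
  have hd : HasDerivAt (fun t : ℝ => mean p (fun a => Real.exp (t * (γ - l a))))
      (γ - mean p l) 0 := by
    have : HasDerivAt (fun t : ℝ => ∑ a, p a * Real.exp (t * (γ - l a)))
        (∑ a, p a * (Real.exp (0 * (γ - l a)) * (1 * (γ - l a)))) 0 :=
      HasDerivAt.fun_sum fun a _ =>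
        (((hasDerivAt_id (0 : ℝ)).mul_const (γ - l a)).exp).const_mul (p a)
    refine HasDerivAt.congr_deriv this ?_
    have h2 := mean_sub p (fun _ => γ) l
    rw [mean_const hp] at h2
    rw [← h2]
    simp [mean]
  have h0 : mean p (fun a => Real.exp (0 * (γ - l a))) = 1 := by
    simp [mean_const hp]
  have hs := (hasDerivAt_iff_tendsto_slope_zero.mp hd).eventually
    (gt_mem_nhds (sub_neg.mpr h))
  have hs' : ∀ᶠ t in 𝓝[>] (0 : ℝ), t⁻¹ • (mean p (fun a => Real.exp ((0 + t) * (γ - l a))) -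
      mean p (fun a => Real.exp (0 * (γ - l a)))) < 0 :=
    hs.filter_mono (nhdsWithin_mono _ fun t (ht : 0 < t) => ht.ne')
  obtain ⟨t, ht, ht0⟩ := (hs'.and self_mem_nhdsWithin).exists
  have ht0 : 0 < t := ht0
  refine ⟨t, ht0, ?_⟩
  rw [h0, zero_add, smul_eq_mul] at ht
  by_contra hc
  exact absurd ht (not_lt.mpr (mul_nonneg (inv_nonneg.mpr ht0.le) (by linarith)))

/-- The number of agreements of a uniform permutation with a fixed map has the exponential
moments of a Poisson variable as upper bounds. -/
theorem sum_perm_pow_card_agree_le {m : ℕ} (g : Fin m → Fin m) {t : ℝ} (ht : 1 ≤ t) :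
    ∑ Θ : Equiv.Perm (Fin m), t ^ (Finset.univ.filter fun j => Θ j = g j).card ≤
      (m.factorial : ℝ) * Real.exp (t - 1) := by
  -- If `Θ₀` agrees with `g` on `T`, every other such `Θ` gives `Θ₀⁻¹ * Θ` fixing `T` pointwise, a
  -- permutation of the complement.
  have hcard : ∀ T : Finset (Fin m),
      ((Finset.univ.filter fun Θ : Equiv.Perm (Fin m) => ∀ j ∈ T, Θ j = g j).card : ℝ) ≤
        ((m - T.card).factorial : ℝ) := by
    intro T
    rcases (Finset.univ.filter fun Θ : Equiv.Perm (Fin m) => ∀ j ∈ T, Θ j = g j).eq_empty_or_nonempty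
      with h | ⟨Θ₀, hΘ₀⟩
    · rw [h]
      simp
    · have h0 := (Finset.mem_filter.mp hΘ₀).2
      have hc : Fintype.card (Equiv.Perm {j // j ∉ T}) = (m - T.card).factorial := by
        rw [Fintype.card_perm, Fintype.card_subtype_compl]
        simp
      rw [← hc, ← Fintype.card_congr (Equiv.Perm.subtypeEquivSubtypePerm fun j => j ∉ T).symm,
        Fintype.card_subtype]
      norm_cast
      refine Finset.card_le_card_of_injOn (fun Θ => Θ₀⁻¹ * Θ) ?_ ?_
      · intro Θ hΘ
        have h1 := (Finset.mem_filter.mp hΘ).2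
        simp only [Finset.coe_filter, Finset.mem_univ, true_and, Set.mem_ofPred_eq, not_not,
          Equiv.Perm.mul_apply]
        intro j hj
        rw [h1 j hj, ← h0 j hj]
        exact Equiv.symm_apply_apply _ _
      · intro Θ _ Θ' _ h
        exact mul_left_cancel h
  -- Write `t = (t - 1) + 1` at each agreement and expand the product over subsets.
  have hexp : ∀ Θ : Equiv.Perm (Fin m),
      t ^ (Finset.univ.filter fun j => Θ j = g j).card =
        ∑ T ∈ (Finset.univ : Finset (Fin m)).powerset,
          (t - 1) ^ T.card * if ∀ j ∈ T, Θ j = g j then 1 else 0 := by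
    intro Θ
    rw [← Finset.prod_const, Finset.prod_filter]
    have : ∀ j, (if Θ j = g j then t else 1) = (t - 1) * (if Θ j = g j then 1 else 0) + 1 := by
      intro j
      split_ifs <;> ring
    simp only [this]
    rw [Finset.prod_add_one]
    refine Finset.sum_congr rfl fun T _ => ?_
    rw [Finset.prod_mul_distrib, Finset.prod_const, Finset.prod_ite_zero]
    simp
  simp only [hexp]
  rw [Finset.sum_comm]
  have h3 : ∀ T ∈ (Finset.univ : Finset (Fin m)).powerset,
      (∑ Θ : Equiv.Perm (Fin m), (t - 1) ^ T.card * if ∀ j ∈ T, Θ j = g j then (1 : ℝ) else 0) ≤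
        (t - 1) ^ T.card * ((m - T.card).factorial : ℝ) := by
    intro T _
    rw [← Finset.mul_sum, Finset.sum_boole]
    exact mul_le_mul_of_nonneg_left (hcard T) (pow_nonneg (by linarith) _)
  refine (Finset.sum_le_sum h3).trans ?_
  rw [Finset.sum_powerset_apply_card (fun k => (t - 1) ^ k * ((m - k).factorial : ℝ))]
  simp only [Finset.card_univ, Fintype.card_fin]
  have h4 : ∀ k ∈ Finset.range (m + 1), m.choose k • ((t - 1) ^ k * ((m - k).factorial : ℝ)) =
      (m.factorial : ℝ) * ((t - 1) ^ k / (k.factorial : ℝ)) := by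
    intro k hk
    have hk' : k ≤ m := Nat.lt_succ_iff.mp (Finset.mem_range.mp hk)
    have := Nat.choose_mul_factorial_mul_factorial hk'
    rw [← this]
    push_cast
    field_simp
    simp
    ring
  rw [Finset.sum_congr rfl h4, ← Finset.mul_sum]
  exact mul_le_mul_of_nonneg_left (Real.sum_le_exp_of_nonneg (by linarith) _) (by positivity)

end FiniteProbability

/-- Coordinates outside the range of `e` integrate to 1, so distinct coordinates of an i.i.d. family
are again i.i.d. -/
theorem mean_piMass_comp {α ι κ : Type*} [Fintype α] [Fintype ι] [DecidableEq ι] [Fintype κ]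
    [DecidableEq κ] {p : α → ℝ} (hp : p ∈ stdSimplex ℝ α) {e : κ → ι}
    (he : Function.Injective e) (F : (κ → α) → ℝ) :
    mean (piMass p) (fun c : ι → α => F fun k => c (e k)) = mean (piMass p) F := by
  classical
  have h1 : ∀ c : ι → α, F (fun k => c (e k)) =
      ∑ y : κ → α, F y * ∏ k, if c (e k) = y k then 1 else 0 := by
    intro c
    have : ∀ y : κ → α, (∏ k, if c (e k) = y k then (1 : ℝ) else 0) =
        if (fun k => c (e k)) = y then 1 else 0 := by
      intro y
      rw [Finset.prod_ite_zero]
      simp [funext_iff]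
    simp [this]
  simp only [h1]
  rw [mean_sum]
  refine Finset.sum_congr rfl fun y _ => ?_
  rw [mean_const_mul, mul_comm]
  congr 1
  set g : ι → α → ℝ := Function.extend e (fun k a => if a = y k then 1 else 0) (fun _ _ => 1)
    with hg
  have h2 : ∀ c : ι → α, (∏ k, if c (e k) = y k then (1 : ℝ) else 0) = ∏ i, g i (c i) := by
    intro c
    refine Fintype.prod_of_injective e he _ _ ?_ ?_
    · intro i hi
      rw [hg, Function.extend_apply' _ _ _ (by simpa using hi)]
    · intro k
      rw [hg, he.extend_apply]
  simp only [h2]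
  rw [mean_piMass_prod, piMass]
  refine (Fintype.prod_of_injective e he _ _ ?_ ?_).symm
  · intro i hi
    rw [hg, Function.extend_apply' _ _ _ (by simpa using hi), mean_const hp]
  · intro k
    rw [hg, he.extend_apply]
    simp [mean]

/-- The real-valued mass function of a `PMF`. -/
def pmfMass {α : Type*} (p : PMF α) (a : α) : ℝ := (p a).toReal

theorem pmfMass_mem_stdSimplex {α : Type*} [Fintype α] (p : PMF α) :
    pmfMass p ∈ stdSimplex ℝ α := by
  refine ⟨fun a => ENNReal.toReal_nonneg, ?_⟩
  have h := p.tsum_coe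
  rw [tsum_fintype] at h
  simp only [pmfMass]
  rw [← ENNReal.toReal_sum fun a _ => p.apply_ne_top a, h, ENNReal.toReal_one]

/-! ### Single entries: likelihood ratios and the mutual information -/

section Letters

variable {A : Type*} [Fintype A] {s : ℕ}

/-- The mass function of an entry together with its noisy copies. -/
def letterMass (pX : PMF A) (W : A → PMF A) (c : A × (Fin s → A)) : ℝ :=
  pmfMass pX c.1 * piMass (pmfMass (W c.1)) c.2

theorem mean_letterMass (pX : PMF A) (W : A → PMF A) (F : A × (Fin s → A) → ℝ) :
    mean (letterMass pX W) F =
      mean (pmfMass pX) fun x => mean (piMass (pmfMass (W x))) fun z => F (x, z) := by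
  simp only [mean, letterMass, Fintype.sum_prod_type, Finset.mul_sum, mul_assoc]

theorem letterMass_mem_stdSimplex (pX : PMF A) (W : A → PMF A) :
    (letterMass pX W : A × (Fin s → A) → ℝ) ∈ stdSimplex ℝ (A × (Fin s → A)) := by
  refine ⟨fun c => mul_nonneg ((pmfMass_mem_stdSimplex pX).1 _)
    ((piMass_mem_stdSimplex (pmfMass_mem_stdSimplex _)).1 _), ?_⟩
  have h := mean_letterMass pX W (fun _ : A × (Fin s → A) => 1)
  simp only [mean_const (piMass_mem_stdSimplex (pmfMass_mem_stdSimplex _)),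
    mean_const (pmfMass_mem_stdSimplex pX)] at h
  simpa [mean] using h

/-- The law of the channel output for the input law `pX`. -/
def outputMass (pX : PMF A) (W : A → PMF A) {r : ℕ} (y : Fin r → A) : ℝ :=
  mean (pmfMass pX) fun x => piMass (pmfMass (W x)) y

theorem outputMass_mem_stdSimplex (pX : PMF A) (W : A → PMF A) (r : ℕ) :
    outputMass pX W ∈ stdSimplex ℝ (Fin r → A) := by
  have h := fun x => piMass_mem_stdSimplex (ι := Fin r) (pmfMass_mem_stdSimplex (W x))
  refine ⟨fun y => mean_nonneg (pmfMass_mem_stdSimplex pX) fun x => (h x).1 y, ?_⟩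
  simp only [outputMass]
  rw [← mean_sum]
  simp only [(h _).2]
  exact mean_const (pmfMass_mem_stdSimplex pX) 1

theorem outputMass_pos {pX : PMF A} {W : A → PMF A} {r : ℕ} {x : A} {y : Fin r → A}
    (hx : 0 < pmfMass pX x) (hy : 0 < piMass (pmfMass (W x)) y) : 0 < outputMass pX W y := by
  refine (mul_pos hx hy).trans_le ?_
  exact Finset.single_le_sum (f := fun x => pmfMass pX x * piMass (pmfMass (W x)) y)
    (fun x _ => mul_nonneg ((pmfMass_mem_stdSimplex pX).1 x)
      ((piMass_mem_stdSimplex (pmfMass_mem_stdSimplex (W x))).1 y)) (Finset.mem_univ x)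

/-- The likelihood ratio of a word of noisy copies of a given entry. -/
def likelihoodRatio (pX : PMF A) (W : A → PMF A) {r : ℕ} (x : A) (y : Fin r → A) : ℝ :=
  piMass (pmfMass (W x)) y / outputMass pX W y

theorem likelihoodRatio_nonneg (pX : PMF A) (W : A → PMF A) {r : ℕ} (x : A) (y : Fin r → A) :
    0 ≤ likelihoodRatio pX W x y :=
  div_nonneg ((piMass_mem_stdSimplex (pmfMass_mem_stdSimplex (W x))).1 y)
    ((outputMass_mem_stdSimplex pX W r).1 y)

/-- The copies that are kept for the repetition number `r`. -/
def truncate (r : Fin (s + 1)) (z : Fin s → A) (l : Fin (r : ℕ)) : A :=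
  z (Fin.castLE (Nat.lt_succ_iff.mp r.2) l)

theorem mean_truncate {p : A → ℝ} (hp : p ∈ stdSimplex ℝ A) (r : Fin (s + 1))
    (F : (Fin (r : ℕ) → A) → ℝ) :
    mean (piMass p) (fun z : Fin s → A => F (truncate r z)) = mean (piMass p) F :=
  mean_piMass_comp hp (Fin.castLE_injective _) F

theorem likelihoodRatio_truncate_pos {pX : PMF A} {W : A → PMF A} {c : A × (Fin s → A)}
    (hc : 0 < letterMass pX W c) (r : Fin (s + 1)) :
    0 < likelihoodRatio pX W c.1 (truncate r c.2) := by
  have hx : 0 < pmfMass pX c.1 := ((pmfMass_mem_stdSimplex pX).1 _).lt_of_ne fun h => by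
    simp [letterMass, ← h] at hc
  have hz : 0 < piMass (pmfMass (W c.1)) c.2 := pos_of_mul_pos_right hc hx.le
  have hy : 0 < piMass (pmfMass (W c.1)) (truncate r c.2) :=
    Finset.prod_pos fun l _ => pos_of_piMass_pos (pmfMass_mem_stdSimplex _) hz _
  exact div_pos hy (outputMass_pos hx hy)

/-- The weight of `S` cancels in the quotient of the joint mass by its marginals, leaving the
likelihood ratio of the word. The right side is in nats and keeps all `s` copies in the sample
space, as the model does. -/
theorem repetitionInfo_mul_log_two (pX : PMF A) (pS : PMF (Fin (s + 1))) (W : A → PMF A) :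
    repetitionInfo pX pS W * Real.log 2 =
      mean (pmfMass pS) fun r => mean (letterMass pX W) fun c =>
        Real.log (likelihoodRatio pX W c.1 (truncate r c.2)) := by
  have hX := pmfMass_mem_stdSimplex pX
  have hS := pmfMass_mem_stdSimplex pS
  have hW := fun (r : ℕ) x => piMass_mem_stdSimplex (ι := Fin r) (pmfMass_mem_stdSimplex (W x))
  have hm : ∀ x, ∑ b, jointMass pX pS W x b = pmfMass pX x := by
    intro x
    rw [Fintype.sum_sigma]
    simp only [jointMass, ← Finset.mul_sum]
    have : ∀ r : Fin (s + 1), ∑ y : Fin (r : ℕ) → A, ∏ l, ((W x) (y l)).toReal = 1 :=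
      fun r => (hW r x).2
    simp only [this, mul_one]
    rw [← Finset.mul_sum]
    exact (congrArg _ hS.2).trans (mul_one _)
  have ho : ∀ b : Σ r : Fin (s + 1), (Fin (r : ℕ) → A), ∑ x, jointMass pX pS W x b =
      pmfMass pS b.1 * outputMass pX W b.2 := by
    intro b
    simp only [jointMass, outputMass, mean, Finset.mul_sum]
    exact Finset.sum_congr rfl fun x _ => by simp only [pmfMass, piMass]; ring
  simp only [repetitionInfo, mutualInfo, hm, ho, Fintype.sum_sigma]
  have ht : ∀ r : Fin (s + 1), (mean (letterMass pX W) fun c =>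
      Real.log (likelihoodRatio pX W c.1 (truncate r c.2))) =
      mean (pmfMass pX) fun x => mean (piMass (pmfMass (W x))) fun y : Fin (r : ℕ) → A =>
        Real.log (likelihoodRatio pX W x y) := by
    intro r
    rw [mean_letterMass]
    congr 1
    funext x
    exact mean_truncate (pmfMass_mem_stdSimplex _) r
      (fun y => Real.log (likelihoodRatio pX W x y))
  simp only [ht]
  rw [mean_comm, mean, Finset.sum_mul]
  refine Finset.sum_congr rfl fun x _ => ?_
  rw [mean, Finset.sum_mul, Finset.mul_sum]
  refine Finset.sum_congr rfl fun r _ => ?_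
  rw [mean, Finset.sum_mul, Finset.mul_sum, Finset.mul_sum]
  refine Finset.sum_congr rfl fun y _ => ?_
  have hj : jointMass pX pS W x ⟨r, y⟩ =
      pmfMass pX x * pmfMass pS r * piMass (pmfMass (W x)) y := rfl
  rw [hj]
  rcases (hX.1 x).eq_or_lt with h | h
  · simp [← h]
  rcases (hS.1 r).eq_or_lt with h' | h'
  · simp [← h']
  have : pmfMass pX x * pmfMass pS r * piMass (pmfMass (W x)) y /
      (pmfMass pX x * (pmfMass pS r * outputMass pX W y)) = likelihoodRatio pX W x y := by
    rw [likelihoodRatio, ← mul_assoc, mul_div_mul_left _ _ (mul_pos h h').ne']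
  rw [this, Real.logb, mul_assoc _ _ (Real.log 2),
    div_mul_cancel₀ _ (Real.log_pos one_lt_two).ne']
  ring

end Letters

/-! ### The error probability as an iterated mean -/

section Model

variable {A : Type*} [Fintype A] {s : ℕ}

theorem sum_sum_eq_sum_pairs {Z : Type*} [Fintype Z] {r n : ℕ}
    (H : (Fin r → Fin n → A) → (Fin r → Fin n → Z) → ℝ) :
    ∑ x, ∑ z, H x z =
      ∑ c : Fin r → Fin n → A × Z, H (fun i j => (c i j).1) (fun i j => (c i j).2) := by
  rw [← Fintype.sum_prod_type']
  refine Fintype.sum_equiv ⟨fun p i j => (p.1 i j, p.2 i j),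
    fun c => (fun i j => (c i j).1, fun i j => (c i j).2), fun p => rfl, fun c => rfl⟩ _ _ ?_
  intro p
  rfl

theorem mean_matrix {Z : Type*} [Fintype Z] (p : A → ℝ) (q : A → Z → ℝ) {r n : ℕ}
    (H : (Fin r → Fin n → A × Z) → ℝ) :
    mean (piMass (piMass fun c : A × Z => p c.1 * q c.1 c.2)) H =
      mean (piMass (piMass p)) fun x : Fin r → Fin n → A => ∑ z : Fin r → Fin n → Z,
        (∏ i, ∏ j, q (x i j) (z i j)) * H (fun i j => (x i j, z i j)) := by
  simp only [mean, Finset.mul_sum]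
  rw [sum_sum_eq_sum_pairs]
  refine Finset.sum_congr rfl fun c _ => ?_
  simp only [piMass, Finset.prod_mul_distrib, mul_assoc]

/-- The error probability as an iterated mean. -/
theorem errorProb_eq_mean (pX : PMF A) (pS : PMF (Fin (s + 1))) (W : A → PMF A) {m B n : ℕ}
    (φ : MatchingMap A m B n) :
    errorProb pX pS W φ =
      mean (piMass (pmfMass pS)) fun S : Fin n → Fin (s + 1) =>
      mean (piMass (piMass (letterMass pX W))) fun g : Fin B → Fin n → A × (Fin s → A) =>
      mean (fun _ => 1 / (Fintype.card (Equiv.Perm (Fin m)) : ℝ)) fun Θ : Equiv.Perm (Fin m) =>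
      mean (piMass (piMass (letterMass pX W))) fun c : Fin m → Fin n → A × (Fin s → A) =>
      mean (fun _ => 1 / (Fintype.card (Fin m) : ℝ)) fun J : Fin m =>
        if Θ J ≠ φ (fun i j => (c i j).1)
          (fun i => repeatRow S fun j => (c (Θ.symm i) j).2) (fun b j => (g b j).1)
          (fun b => repeatRow S fun j => (g b j).2) J then 1 else 0 := by
  simp only [errorProb, mean, Finset.mul_sum]
  refine Finset.sum_congr rfl fun S _ => ?_
  simp only [sum_sum_eq_sum_pairs (r := B)]
  simp only [sum_sum_eq_sum_pairs (r := m)]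
  -- The seeds move outside `Θ` and the database, so that the converse can freeze them together with
  -- `S`.
  rw [Finset.sum_congr rfl fun Θ _ => Finset.sum_comm, Finset.sum_comm]
  refine Finset.sum_congr rfl fun g _ => Finset.sum_congr rfl fun Θ _ =>
    Finset.sum_congr rfl fun c _ => Finset.sum_congr rfl fun J _ => ?_
  have h : ∀ {r : ℕ} (c : Fin r → Fin n → A × (Fin s → A)),
      dataMass pX W (fun i j => (c i j).1) (fun i j => (c i j).2) =
        piMass (piMass (letterMass pX W)) c := fun c => rfl
  rw [h, h, Fintype.card_perm, Fintype.card_fin]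
  simp only [patternMass, piMass, pmfMass]
  ring

end Model

/-! ### Rows as functions of the kept words -/

section Rows

variable {A : Type*} {s : ℕ}

/-- The concatenation of the words of a row. -/
def concatRow {n : ℕ} {S : Fin n → Fin (s + 1)} (y : ∀ j, Fin (S j : ℕ) → A) : List A :=
  (List.ofFn fun j => List.ofFn (y j)).flatten

theorem repeatRow_eq_concatRow {n : ℕ} (S : Fin n → Fin (s + 1)) (z : Fin n → Fin s → A) :
    repeatRow S z = concatRow (S := S) fun j => truncate (S j) (z j) := by
  have h : ∀ j, (List.ofFn (z j)).take (S j : ℕ) = List.ofFn (truncate (S j) (z j)) := by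
    intro j
    have hj : (S j : ℕ) ≤ s := Nat.lt_succ_iff.mp (S j).2
    refine List.ext_getElem (by simp [hj]) fun k h1 h2 => ?_
    simp [truncate, Fin.castLE]
  simp only [repeatRow, concatRow, h]

end Rows

/-! ### The converse by change of measure -/

section Converse

variable {A : Type*} [Fintype A] {s : ℕ}

/-- The likelihood ratio of a whole row for the repetition pattern `S`. -/
def rowRatio (pX : PMF A) (W : A → PMF A) {n : ℕ} (S : Fin n → Fin (s + 1)) (x : Fin n → A)
    (y : ∀ j, Fin (S j : ℕ) → A) : ℝ :=
  ∏ j, likelihoodRatio pX W (x j) (y j)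

/-- The number of arguments at which a permutation agrees with a map. -/
def agreement {m : ℕ} (Θ : Equiv.Perm (Fin m)) (g : Fin m → Fin m) : ℕ :=
  (Finset.univ.filter fun j => Θ j = g j).card

/-- Given the entries, discarded copies integrate to 1. The word lengths depend on the column, hence
the dependent pushforward, used once over columns and once over rows. -/
theorem sum_word_truncate {n m : ℕ} (W : A → PMF A) (S : Fin n → Fin (s + 1))
    (x : Fin m → Fin n → A) (F : (Fin m → ∀ j, Fin (S j : ℕ) → A) → ℝ) :
    ∑ z : Fin m → Fin n → Fin s → A, (∏ i, ∏ j, piMass (pmfMass (W (x i j))) (z i j)) *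
        F (fun i j => truncate (S j) (z i j)) =
      ∑ y : Fin m → ∀ j, Fin (S j : ℕ) → A,
        (∏ i, ∏ j, piMass (pmfMass (W (x i j))) (y i j)) * F y := by
  have hrow : ∀ (i : Fin m) (G : (∀ j, Fin (S j : ℕ) → A) → ℝ),
      ∑ z : Fin n → Fin s → A, (∏ j, piMass (pmfMass (W (x i j))) (z j)) *
        G (fun j => truncate (S j) (z j)) =
      ∑ y : ∀ j, Fin (S j : ℕ) → A, (∏ j, piMass (pmfMass (W (x i j))) (y j)) * G y := by
    intro i G
    exact sum_pi_pushforward (Z := fun _ : Fin n => Fin s → A)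
      (Y := fun j => Fin (S j : ℕ) → A) (fun j z => truncate (S j) z)
      (fun j z => piMass (pmfMass (W (x i j))) z) (fun j y => piMass (pmfMass (W (x i j))) y)
      (fun j H => mean_truncate (pmfMass_mem_stdSimplex _) (S j) H) G
  exact sum_pi_pushforward (Z := fun _ : Fin m => Fin n → Fin s → A)
    (Y := fun _ => ∀ j, Fin (S j : ℕ) → A) (fun _ z j => truncate (S j) (z j))
    (fun i z => ∏ j, piMass (pmfMass (W (x i j))) (z j))
    (fun i y => ∏ j, piMass (pmfMass (W (x i j))) (y j)) hrow F

/-- Equality holds unless the word is impossible for `x`; then the left side is `0 / 0 = 0`. -/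
theorem mul_div_likelihoodRatio_le (pX : PMF A) (W : A → PMF A) {r : ℕ} (x : A)
    (y : Fin r → A) :
    piMass (pmfMass (W x)) y / likelihoodRatio pX W x y ≤ outputMass pX W y := by
  rw [likelihoodRatio]
  rcases eq_or_ne (piMass (pmfMass (W x)) y) 0 with h | h
  · rw [h]
    simpa using (outputMass_mem_stdSimplex pX W r).1 y
  · rw [div_div_cancel₀ h]

/-- The exponential moments of the number of correctly matched rows after the change to the
measure under which the two databases are independent. -/
theorem mean_pow_agreement_div_rowRatio_le (pX : PMF A) (W : A → PMF A) {m n : ℕ}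
    (S : Fin n → Fin (s + 1))
    (ψ : (Fin m → Fin n → A) → (Fin m → List A) → Fin m → Fin m) {t : ℝ} (ht : 1 ≤ t) :
    (mean (fun _ => 1 / (Fintype.card (Equiv.Perm (Fin m)) : ℝ)) fun Θ : Equiv.Perm (Fin m) =>
      mean (piMass (piMass (letterMass pX W))) fun c : Fin m → Fin n → A × (Fin s → A) =>
        t ^ agreement Θ (ψ (fun i j => (c i j).1)
          fun i => repeatRow S fun j => (c (Θ.symm i) j).2) /
          ∏ i, rowRatio pX W S (fun j => (c i j).1) fun j => truncate (S j) (c i j).2) ≤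
      Real.exp (t - 1) := by
  have hX := piMass_mem_stdSimplex (ι := Fin m)
    (piMass_mem_stdSimplex (ι := Fin n) (pmfMass_mem_stdSimplex pX))
  have ht0 : 0 < t := by linarith
  have hΘ : ∀ Θ : Equiv.Perm (Fin m),
      (mean (piMass (piMass (letterMass pX W))) fun c : Fin m → Fin n → A × (Fin s → A) =>
        t ^ agreement Θ (ψ (fun i j => (c i j).1)
          fun i => repeatRow S fun j => (c (Θ.symm i) j).2) /
          ∏ i, rowRatio pX W S (fun j => (c i j).1) fun j => truncate (S j) (c i j).2) ≤
      mean (piMass (piMass (pmfMass pX))) fun x => ∑ y : Fin m → ∀ j, Fin (S j : ℕ) → A,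
        (∏ i, ∏ j, outputMass pX W (y i j)) *
          t ^ agreement Θ (ψ x fun i => concatRow (y i)) := by
    intro Θ
    refine (mean_matrix (pmfMass pX) (fun x z => piMass (pmfMass (W x)) z) _).trans_le ?_
    refine mean_mono hX fun x _ => ?_
    simp only [repeatRow_eq_concatRow]
    refine (sum_word_truncate W S x (fun y => t ^ agreement Θ (ψ x fun i =>
      concatRow (y (Θ.symm i))) / ∏ i, rowRatio pX W S (x i) (y i))).trans_le ?_
    -- The product output law does not change when rows are permuted, so `Θ` disappears from the
    -- argument of `ψ`: under the new measure the estimate is independent of `Θ`.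
    have hre := Fintype.sum_equiv (Equiv.arrowCongr Θ (Equiv.refl _))
      (fun y : Fin m → ∀ j, Fin (S j : ℕ) → A => (∏ i, ∏ j, outputMass pX W (y i j)) *
        t ^ agreement Θ (ψ x fun i => concatRow (y (Θ.symm i))))
      (fun y => (∏ i, ∏ j, outputMass pX W (y i j)) *
          t ^ agreement Θ (ψ x fun i => concatRow (y i))) (fun y => by
        congr 1
        exact Fintype.prod_equiv Θ _ _ fun i => by simp [Equiv.arrowCongr])
    rw [← hre]
    refine Finset.sum_le_sum fun y _ => ?_
    rw [mul_div_left_comm, mul_comm]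
    refine mul_le_mul_of_nonneg_right ?_ (pow_nonneg ht0.le _)
    simp only [rowRatio, ← Finset.prod_div_distrib]
    have h0 : ∀ i j, 0 ≤ piMass (pmfMass (W (x i j))) (y i j) /
        likelihoodRatio pX W (x i j) (y i j) := fun i j =>
      div_nonneg ((piMass_mem_stdSimplex (pmfMass_mem_stdSimplex _)).1 _)
        (likelihoodRatio_nonneg _ _ _ _)
    exact Finset.prod_le_prod (fun i _ => Finset.prod_nonneg fun j _ => h0 i j) fun i _ =>
      Finset.prod_le_prod (fun j _ => h0 i j) fun j _ => mul_div_likelihoodRatio_le _ _ _ _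
  refine (mean_mono uniform_mem_stdSimplex fun Θ _ => hΘ Θ).trans ?_
  rw [mean_comm]
  refine (mean_mono hX (G := fun _ => Real.exp (t - 1)) fun x _ => ?_).trans_eq
    (mean_const hX _)
  rw [mean_sum]
  simp only [mean_const_mul]
  -- Total mass of a product law, obtained by pushing every factor forward to a point.
  have hone : ∑ y : Fin m → ∀ j, Fin (S j : ℕ) → A, ∏ i, ∏ j, outputMass pX W (y i j) = 1 := by
    have h := sum_pi_pushforward (fun (_ : Fin m) (_ : ∀ j, Fin (S j : ℕ) → A) => ())
      (fun _ y => ∏ j, outputMass pX W (y j)) (fun _ _ => 1) (fun _ F => by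
        have := sum_pi_pushforward (fun (j : Fin n) (_ : Fin (S j : ℕ) → A) => ())
          (fun j y => outputMass pX W y) (fun _ _ => 1) (fun j F => by
            rw [← Finset.sum_mul, (outputMass_mem_stdSimplex pX W _).2]
            simp) (fun _ => 1)
        simp only [mul_one, Finset.prod_const_one, Finset.sum_const, Finset.card_univ,
          Fintype.card_unique, one_smul] at this
        rw [← Finset.sum_mul, this]
        simp) (fun _ => 1)
    simpa using h
  calc _ ≤ ∑ y : Fin m → ∀ j, Fin (S j : ℕ) → A, (∏ i, ∏ j, outputMass pX W (y i j)) *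
        Real.exp (t - 1) := by
        refine Finset.sum_le_sum fun y _ => mul_le_mul_of_nonneg_left ?_
          (Finset.prod_nonneg fun i _ => Finset.prod_nonneg fun j _ =>
            (outputMass_mem_stdSimplex pX W _).1 _)
        have := sum_perm_pow_card_agree_le (ψ x fun i => concatRow (y i)) ht
        rw [mean, ← Finset.mul_sum, Fintype.card_perm, Fintype.card_fin, one_div,
          inv_mul_le_iff₀ (by positivity)]
        exact this
    _ = Real.exp (t - 1) := by rw [← Finset.sum_mul, hone, one_mul]

/-- The mean log-likelihood ratio of the two databases. -/
theorem mean_sum_log_rowRatio (pX : PMF A) (pS : PMF (Fin (s + 1))) (W : A → PMF A)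
    (m n : ℕ) :
    (mean (piMass (pmfMass pS)) fun S : Fin n → Fin (s + 1) =>
      mean (piMass (piMass (letterMass pX W))) fun c : Fin m → Fin n → A × (Fin s → A) =>
        ∑ i, ∑ j, Real.log (likelihoodRatio pX W (c i j).1 (truncate (S j) (c i j).2))) =
      m * n * (repetitionInfo pX pS W * Real.log 2) := by
  have hL := letterMass_mem_stdSimplex (s := s) pX W
  have hR := piMass_mem_stdSimplex (ι := Fin n) hL
  simp only [mean_sum]
  have h : ∀ (S : Fin n → Fin (s + 1)) (i : Fin m) (j : Fin n),
      (mean (piMass (piMass (letterMass pX W))) fun c : Fin m → Fin n → A × (Fin s → A) =>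
        Real.log (likelihoodRatio pX W (c i j).1 (truncate (S j) (c i j).2))) =
      mean (letterMass pX W) fun c =>
        Real.log (likelihoodRatio pX W c.1 (truncate (S j) c.2)) := by
    intro S i j
    rw [mean_piMass_eval hR i (fun d : Fin n → A × (Fin s → A) =>
        Real.log (likelihoodRatio pX W (d j).1 (truncate (S j) (d j).2))),
      mean_piMass_eval hL j (fun c : A × (Fin s → A) =>
        Real.log (likelihoodRatio pX W c.1 (truncate (S j) c.2)))]
  simp only [h]
  have h' : ∀ j : Fin n, (mean (piMass (pmfMass pS)) fun S : Fin n → Fin (s + 1) =>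
      mean (letterMass pX W) fun c =>
        Real.log (likelihoodRatio pX W c.1 (truncate (S j) c.2))) =
      repetitionInfo pX pS W * Real.log 2 := by
    intro j
    rw [repetitionInfo_mul_log_two]
    exact mean_piMass_eval (pmfMass_mem_stdSimplex pS) j (fun r =>
      mean (letterMass pX W) fun c => Real.log (likelihoodRatio pX W c.1 (truncate r c.2)))
  simp only [h', Finset.sum_const, Finset.card_univ, Fintype.card_fin, nsmul_eq_mul]
  ring

theorem mean_ne_eq {m : ℕ} [NeZero m] (Θ : Equiv.Perm (Fin m)) (g : Fin m → Fin m) :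
    (mean (fun _ => 1 / (Fintype.card (Fin m) : ℝ)) fun J : Fin m =>
      if Θ J ≠ g J then (1 : ℝ) else 0) = 1 - (agreement Θ g : ℝ) * (m : ℝ)⁻¹ := by
  have hm : (m : ℝ) ≠ 0 := Nat.cast_ne_zero.mpr (NeZero.ne m)
  have h : ∀ J, (if Θ J ≠ g J then (1 : ℝ) else 0) = 1 - if Θ J = g J then 1 else 0 := by
    intro J
    by_cases h : Θ J = g J <;> simp [h]
  simp only [h]
  rw [mean_sub, mean_const uniform_mem_stdSimplex]
  simp only [mean, ← Finset.mul_sum, Finset.sum_boole, agreement, Fintype.card_fin]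
  ring

/-- The single-size form of the converse. -/
theorem one_sub_errorProb_mul_log_le (pX : PMF A) (pS : PMF (Fin (s + 1))) (W : A → PMF A)
    {m B n : ℕ} (hm : 0 < m) (φ : MatchingMap A m B n) :
    (1 - errorProb pX pS W φ) * Real.log m ≤ n * (repetitionInfo pX pS W * Real.log 2) + 1 := by
  have : NeZero m := ⟨hm.ne'⟩
  have hm0 : (0 : ℝ) < m := Nat.cast_pos.mpr hm
  have hm1 : (1 : ℝ) ≤ m := Nat.one_le_cast.mpr hm
  have hS := piMass_mem_stdSimplex (ι := Fin n) (pmfMass_mem_stdSimplex pS)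
  have hL := letterMass_mem_stdSimplex (s := s) pX W
  have hG := piMass_mem_stdSimplex (ι := Fin B) (piMass_mem_stdSimplex (ι := Fin n) hL)
  have hC := piMass_mem_stdSimplex (ι := Fin m) (piMass_mem_stdSimplex (ι := Fin n) hL)
  have hP := uniform_mem_stdSimplex (α := Equiv.Perm (Fin m))
  rw [errorProb_eq_mean]
  simp only [mean_ne_eq]
  have key : ∀ S : Fin n → Fin (s + 1),
      ∀ g : Fin B → Fin n → A × (Fin s → A),
      (mean (fun _ => 1 / (Fintype.card (Equiv.Perm (Fin m)) : ℝ)) fun Θ : Equiv.Perm (Fin m) =>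
        mean (piMass (piMass (letterMass pX W))) fun c : Fin m → Fin n → A × (Fin s → A) =>
          (agreement Θ (φ (fun i j => (c i j).1)
            (fun i => repeatRow S fun j => (c (Θ.symm i) j).2) (fun b j => (g b j).1)
            (fun b => repeatRow S fun j => (g b j).2)) : ℝ)) * Real.log m ≤
      (mean (piMass (piMass (letterMass pX W))) fun c : Fin m → Fin n → A × (Fin s → A) =>
        ∑ i, ∑ j, Real.log (likelihoodRatio pX W (c i j).1 (truncate (S j) (c i j).2))) + m := by
    intro S g
    -- The choice `t = m` makes the logarithm of `t ^ N` equal to `N * log m`, at a cost of `m - 1`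
    -- nats, less than one per row.
    have hb := mean_pow_agreement_div_rowRatio_le pX W S
      (fun x y => φ x y (fun b j => (g b j).1) (fun b => repeatRow S fun j => (g b j).2)) hm1
    have he : (0 : ℝ) < Real.exp (m - 1) := Real.exp_pos _
    rw [← div_le_one he, div_eq_mul_inv, ← mean_mul_const] at hb
    simp only [← mean_mul_const] at hb ⊢
    have hpt := fun (Θ : Equiv.Perm (Fin m)) =>
      mean_mono hC (F := fun c : Fin m → Fin n → A × (Fin s → A) =>
          (agreement Θ (φ (fun i j => (c i j).1)
            (fun i => repeatRow S fun j => (c (Θ.symm i) j).2) (fun b j => (g b j).1)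
            (fun b => repeatRow S fun j => (g b j).2)) : ℝ) * Real.log m)
        -- This is `log u ≤ u - 1` for `u = m ^ N / (L * exp (m - 1))`, where `L` is the product of
        -- the row ratios; `m - 2` is `(m - 1) - 1`, and `u` has mean at most 1.
        (G := fun c => (∑ i, ∑ j,
          Real.log (likelihoodRatio pX W (c i j).1 (truncate (S j) (c i j).2))) + (m - 2) +
          (m : ℝ) ^ agreement Θ (φ (fun i j => (c i j).1)
            (fun i => repeatRow S fun j => (c (Θ.symm i) j).2) (fun b j => (g b j).1)
            (fun b => repeatRow S fun j => (g b j).2)) /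
          (∏ i, rowRatio pX W S (fun j => (c i j).1) fun j => truncate (S j) (c i j).2) *
          (Real.exp (m - 1))⁻¹) (by
        intro c hc
        have hlr : ∀ i j, 0 < likelihoodRatio pX W (c i j).1 (truncate (S j) (c i j).2) :=
          fun i j => likelihoodRatio_truncate_pos
            (pos_of_piMass_pos hL (pos_of_piMass_pos (piMass_mem_stdSimplex hL) hc i) j) (S j)
        have hrow : ∀ i, 0 < rowRatio pX W S (fun j => (c i j).1)
            fun j => truncate (S j) (c i j).2 := fun i => Finset.prod_pos fun j _ => hlr i j
        have hprod := Finset.prod_pos fun i (_ : i ∈ Finset.univ) => hrow i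
        have hsum : ∑ i, ∑ j,
            Real.log (likelihoodRatio pX W (c i j).1 (truncate (S j) (c i j).2)) =
            Real.log (∏ i, rowRatio pX W S (fun j => (c i j).1)
              fun j => truncate (S j) (c i j).2) := by
          rw [Real.log_prod fun i _ => (hrow i).ne']
          exact Finset.sum_congr rfl fun i _ => (Real.log_prod fun j _ => (hlr i j).ne').symm
        rw [hsum]
        set N := agreement Θ _
        have hpow : (0 : ℝ) < (m : ℝ) ^ N := pow_pos hm0 _
        have h1 := Real.log_le_sub_one_of_pos
          (mul_pos (div_pos hpow hprod) (inv_pos.mpr he))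
        rw [Real.log_mul (div_pos hpow hprod).ne' (inv_pos.mpr he).ne',
          Real.log_div hpow.ne' hprod.ne', Real.log_inv, Real.log_exp, Real.log_pow] at h1
        linarith)
    refine (mean_mono hP fun Θ _ => hpt Θ).trans ?_
    simp only [mean_add, mean_const hC, mean_const hP]
    linarith
  have h2 := mean_mono hS fun S _ => mean_mono hG fun g _ => key S g
  simp only [mean_mul_const, mean_add, mean_const hG, mean_const hS] at h2
  rw [mean_sum_log_rowRatio] at h2
  simp only [mean_sub, mean_const hC, mean_const hP, mean_const hG, mean_const hS,
    mean_mul_const]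
  rw [sub_sub_cancel, mul_right_comm, ← div_eq_mul_inv, div_le_iff₀ hm0]
  linarith

theorem converse (pX : PMF A) (pS : PMF (Fin (s + 1))) (W : A → PMF A) (R : ℝ) (m B : ℕ → ℕ)
    (hm : HasGrowthRate m R) (φ : ∀ n, MatchingMap A (m n) (B n) n)
    (hφ : Successful pX pS W m B φ) : R ≤ repetitionInfo pX pS W := by
  have hlog : (0 : ℝ) < Real.log 2 := Real.log_pos one_lt_two
  have h1 : Tendsto (fun n : ℕ => (1 - errorProb pX pS W (φ n)) *
      (Real.logb 2 (m n : ℝ) / (n : ℝ)) * Real.log 2) atTop (𝓝 ((1 - 0) * R * Real.log 2)) :=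
    ((tendsto_const_nhds.sub hφ).mul hm.2).mul_const _
  have h2 : Tendsto (fun n : ℕ => repetitionInfo pX pS W * Real.log 2 + 1 / (n : ℝ)) atTop
      (𝓝 (repetitionInfo pX pS W * Real.log 2 + 0)) :=
    tendsto_const_nhds.add tendsto_one_div_atTop_nhds_zero_nat
  have h3 := le_of_tendsto_of_tendsto h1 h2 (by
    filter_upwards [eventually_gt_atTop 0] with n hn
    have hn0 : (0 : ℝ) < n := Nat.cast_pos.mpr hn
    have := one_sub_errorProb_mul_log_le pX pS W (hm.1 n) (φ n)
    calc _ = (1 - errorProb pX pS W (φ n)) * Real.log (m n) / n := by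
          rw [Real.logb]
          field_simp
      _ ≤ (n * (repetitionInfo pX pS W * Real.log 2) + 1) / n := by gcongr
      _ = _ := by field_simp)
  rw [sub_zero, one_mul, add_zero] at h3
  exact le_of_mul_le_mul_right h3 hlog

end Converse

/-! ### Reading the repetition pattern off the seeds -/

section Positions

variable {A : Type*} {s : ℕ}

/-- The positions in the table of noisy copies that are kept by the pattern `S`. -/
def positions {n : ℕ} (S : Fin n → Fin (s + 1)) : List (Fin n × Fin s) :=
  (List.ofFn fun j => (List.ofFn fun l => (j, l)).take (S j : ℕ)).flatten

/-- The addresses depend on `S` alone, so the `i`-th letters of all labeled seeds come from one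
column of the table. -/
theorem repeatRow_eq_map_positions {n : ℕ} (S : Fin n → Fin (s + 1)) (z : Fin n → Fin s → A) :
    repeatRow S z = (positions S).map fun p => z p.1 p.2 := by
  simp only [repeatRow, positions, List.map_flatten, List.map_ofFn]
  congr 2
  funext j
  simp only [Function.comp, List.map_take, List.map_ofFn]
  rfl

theorem count_map_fst_positions {n : ℕ} (S : Fin n → Fin (s + 1)) (j : Fin n) :
    ((positions S).map Prod.fst).count j = S j := by
  have h : ∀ k, ((List.ofFn fun l : Fin s => (k, l)).take (S k : ℕ)).map Prod.fst =
      List.replicate (S k : ℕ) k := by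
    intro k
    have hk : (S k : ℕ) ≤ s := Nat.lt_succ_iff.mp (S k).2
    refine List.ext_getElem (by simp [hk]) fun i h1 h2 => ?_
    simp
  simp only [positions, List.map_flatten, List.map_ofFn, List.count_flatten, Function.comp_def,
    h, List.count_replicate, List.sum_ofFn]
  simp

/-- Once `S` is known, the concatenation can be cut back into its words. -/
theorem truncate_eq_of_repeatRow_eq {n : ℕ} {S : Fin n → Fin (s + 1)}
    {z z' : Fin n → Fin s → A} (h : repeatRow S z = repeatRow S z') (j : Fin n) :
    truncate (S j) (z j) = truncate (S j) (z' j) := by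
  rw [repeatRow_eq_map_positions, repeatRow_eq_map_positions, List.map_inj_left] at h
  funext l
  have hj : (S j : ℕ) ≤ s := Nat.lt_succ_iff.mp (S j).2
  refine h (j, Fin.castLE hj l) ?_
  refine List.mem_flatten.mpr ⟨_, (List.mem_ofFn' _ _).mpr ⟨j, rfl⟩, ?_⟩
  rw [List.mem_take_iff_getElem]
  refine ⟨l, by simp [hj, l.2], ?_⟩
  simp [Fin.castLE]

/-- A test for pairs of columns that identifies exactly the pairs with a common source. -/
def Separates {B n : ℕ} (T : (Fin B → A) → (Fin B → A) → Prop) (x : Fin B → Fin n → A)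
    (z : Fin B → Fin n → Fin s → A) : Prop :=
  ∀ j k l, T (fun b => x b j) (fun b => z b k l) ↔ j = k

/-- The seeds determine the repetition pattern when the column test makes no error. -/
theorem Separates.pattern_eq {B n : ℕ} (hB : 0 < B) {T : (Fin B → A) → (Fin B → A) → Prop}
    {x : Fin B → Fin n → A} {z z' : Fin B → Fin n → Fin s → A} (h : Separates T x z)
    (h' : Separates T x z') {S S' : Fin n → Fin (s + 1)}
    (heq : ∀ b, repeatRow S (z b) = repeatRow S' (z' b)) : S = S' := by
  simp only [repeatRow_eq_map_positions] at heq
  -- A single seed row already fixes the total number of kept letters; this is where `0 < B` enters.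
  have hlen : (positions S).length = (positions S').length := by
    simpa using congrArg List.length (heq ⟨0, hB⟩)
  have hfst : (positions S).map Prod.fst = (positions S').map Prod.fst := by
    refine List.ext_getElem (by simpa using hlen) fun i h1 h2 => ?_
    rw [List.length_map] at h1 h2
    have hcol : (fun b => z b (positions S)[i].1 (positions S)[i].2) =
        fun b => z' b (positions S')[i].1 (positions S')[i].2 := by
      funext b
      have := List.getElem_of_eq (heq b) (i := i) (by simpa using h1)
      simpa using this
    -- The test sees only the two columns of letters, so its verdict on the source carries over from
    -- `z` to `z'`.
    have ht := (h (positions S)[i].1 (positions S)[i].1 (positions S)[i].2).mpr rfl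
    rw [hcol] at ht
    simpa using (h' _ _ _).mp ht
  funext j
  -- The repetition number `S j` is the multiplicity of `j` among the source columns.
  have := congrArg (List.count j) hfst
  rw [count_map_fst_positions, count_map_fst_positions] at this
  exact Fin.ext this

end Positions

/-! ### The column test and its error exponent -/

section ColumnTest

variable {A : Type*} [Fintype A] {s : ℕ}

/-- The law of a single channel output. -/
def outputLetter (pX : PMF A) (W : A → PMF A) (y : A) : ℝ :=
  mean (pmfMass pX) fun x => pmfMass (W x) y

theorem outputLetter_nonneg (pX : PMF A) (W : A → PMF A) (y : A) : 0 ≤ outputLetter pX W y :=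
  mean_nonneg (pmfMass_mem_stdSimplex pX) fun x => (pmfMass_mem_stdSimplex (W x)).1 y

theorem mean_outputLetter (pX : PMF A) (W : A → PMF A) (F : A → ℝ) :
    mean (pmfMass pX) (fun x => mean (pmfMass (W x)) F) = ∑ y, outputLetter pX W y * F y := by
  simp only [outputLetter, ← mean_mul_const, ← mean_sum]
  rfl

/-- The Bhattacharyya coefficient of the joint law of input and output and the product of its
marginals. -/
def bhattacharyya (pX : PMF A) (W : A → PMF A) : ℝ :=
  mean (pmfMass pX) fun x => ∑ y, √(pmfMass (W x) y * outputLetter pX W y)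

theorem bhattacharyya_nonneg (pX : PMF A) (W : A → PMF A) : 0 ≤ bhattacharyya pX W :=
  mean_nonneg (pmfMass_mem_stdSimplex pX) fun _ => Finset.sum_nonneg fun _ _ => Real.sqrt_nonneg _

/-- One minus the coefficient is half the mean squared distance of `√W` and the root of the output
law. Were it not positive, the output law would be the same for all inputs in the support and the
information would vanish. -/
theorem bhattacharyya_lt_one (pX : PMF A) (pS : PMF (Fin (s + 1))) (W : A → PMF A)
    (h : 0 < repetitionInfo pX pS W) : bhattacharyya pX W < 1 := by
  have hX := pmfMass_mem_stdSimplex pX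
  have hW := fun x => pmfMass_mem_stdSimplex (W x)
  have hq := outputLetter_nonneg pX W
  by_contra hρ
  push Not at hρ
  have hsum : ∑ y, outputLetter pX W y = 1 := by
    have h1 := mean_outputLetter pX W (fun _ => 1)
    simp only [mean_const (hW _), mean_const hX, mul_one] at h1
    exact h1.symm
  have hid : ∀ x, ∑ y, (√(pmfMass (W x) y) - √(outputLetter pX W y)) ^ 2 =
      2 - 2 * ∑ y, √(pmfMass (W x) y * outputLetter pX W y) := by
    intro x
    have : ∀ y, (√(pmfMass (W x) y) - √(outputLetter pX W y)) ^ 2 =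
        pmfMass (W x) y + outputLetter pX W y -
          2 * √(pmfMass (W x) y * outputLetter pX W y) := by
      intro y
      rw [sub_sq, Real.sq_sqrt ((hW x).1 y), Real.sq_sqrt (hq y), Real.sqrt_mul ((hW x).1 y)]
      ring
    simp only [this, Finset.sum_sub_distrib, Finset.sum_add_distrib, (hW x).2, hsum,
      ← Finset.mul_sum]
    ring
  have hle : (mean (pmfMass pX) fun x =>
      ∑ y, (√(pmfMass (W x) y) - √(outputLetter pX W y)) ^ 2) ≤ 0 := by
    simp only [hid]
    rw [mean_sub, mean_const hX, mean_const_mul]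
    change 2 - 2 * bhattacharyya pX W ≤ 0
    linarith
  have hterm : ∀ x, 0 < pmfMass pX x → ∀ y, pmfMass (W x) y = outputLetter pX W y := by
    have h0 : ∀ x, 0 ≤ ∑ y, (√(pmfMass (W x) y) - √(outputLetter pX W y)) ^ 2 :=
      fun x => Finset.sum_nonneg fun y _ => sq_nonneg _
    have hz := (Finset.sum_eq_zero_iff_of_nonneg
      (fun x _ => mul_nonneg (hX.1 x) (h0 x))).mp (le_antisymm hle (mean_nonneg hX h0))
    intro x hx y
    have hx' := (mul_eq_zero.mp (hz x (Finset.mem_univ x))).resolve_left hx.ne'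
    have hy := (Finset.sum_eq_zero_iff_of_nonneg (fun y _ => sq_nonneg _)).mp hx' y
      (Finset.mem_univ y)
    rw [sq_eq_zero_iff, sub_eq_zero] at hy
    exact (Real.sqrt_inj ((hW x).1 y) (hq y)).mp hy
  have hlr : ∀ (r : ℕ) x, 0 < pmfMass pX x → ∀ y : Fin r → A,
      Real.log (likelihoodRatio pX W x y) = 0 := by
    intro r x hx y
    have h1 : ∀ x, 0 < pmfMass pX x →
        piMass (pmfMass (W x)) y = ∏ l, outputLetter pX W (y l) :=
      fun x hx => Finset.prod_congr rfl fun l _ => hterm x hx (y l)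
    rw [likelihoodRatio, outputMass, mean_congr hX h1, mean_const hX, h1 x hx]
    -- For a word of probability 0 the ratio is `0 / 0 = 0`, and `Real.log 0 = 0`.
    rcases eq_or_ne (∏ l, outputLetter pX W (y l)) 0 with h | h
    · simp [h]
    · simp [div_self h]
  have hI := repetitionInfo_mul_log_two pX pS W
  have h0 : ∀ r : Fin (s + 1), (mean (letterMass pX W) fun c : A × (Fin s → A) =>
      Real.log (likelihoodRatio pX W c.1 (truncate r c.2))) = 0 := by
    intro r
    rw [mean_letterMass]
    simp only [mean_congr hX (fun x hx => by simp only [hlr r x hx] :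
      ∀ x, 0 < pmfMass pX x → (mean (piMass (pmfMass (W x))) fun z : Fin s → A =>
        Real.log (likelihoodRatio pX W x (truncate r z))) = mean (piMass (pmfMass (W x)))
          fun z : Fin s → A => 0)]
    simp [mean]
  simp only [h0, mean_const (pmfMass_mem_stdSimplex pS)] at hI
  exact (mul_pos h (Real.log_pos one_lt_two)).ne' hI

/-- The likelihood ratio test for the dependence of two columns. -/
def ColumnTest (pX : PMF A) (W : A → PMF A) {B : ℕ} (x y : Fin B → A) : Prop :=
  ∏ b, outputLetter pX W (y b) < ∏ b, pmfMass (W (x b)) (y b)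

/-- Chernoff's bound with exponent 1/2: the root of the likelihood ratio dominates the indicator of
a test error and factors over the seeds. -/
theorem one_le_prod_sqrt_div {B : ℕ} {u v : Fin B → ℝ} (hu : ∀ b, 0 ≤ u b) (hv : ∀ b, 0 < v b)
    (h : ∏ b, v b ≤ ∏ b, u b) : 1 ≤ ∏ b, √(u b / v b) := by
  have h0 : 0 ≤ ∏ b, √(u b / v b) := Finset.prod_nonneg fun b _ => Real.sqrt_nonneg _
  rw [← one_le_sq_iff₀ h0, ← Finset.prod_pow]
  simp only [Real.sq_sqrt (div_nonneg (hu _) (hv _).le), Finset.prod_div_distrib]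
  rwa [one_le_div (Finset.prod_pos fun b _ => hv b)]

theorem pos_of_letterMass_pos {pX : PMF A} {W : A → PMF A} {c : A × (Fin s → A)}
    (hc : 0 < letterMass pX W c) :
    0 < pmfMass pX c.1 ∧ ∀ l, 0 < pmfMass (W c.1) (c.2 l) := by
  have hx : 0 < pmfMass pX c.1 := ((pmfMass_mem_stdSimplex pX).1 _).lt_of_ne fun h => by
    simp [letterMass, ← h] at hc
  exact ⟨hx, pos_of_piMass_pos (pmfMass_mem_stdSimplex _) (pos_of_mul_pos_right hc hx.le)⟩

theorem outputLetter_pos {pX : PMF A} {W : A → PMF A} {x y : A}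
    (hx : 0 < pmfMass pX x) (hy : 0 < pmfMass (W x) y) : 0 < outputLetter pX W y :=
  (mul_pos hx hy).trans_le (Finset.single_le_sum (f := fun x => pmfMass pX x * pmfMass (W x) y)
    (fun x _ => mul_nonneg ((pmfMass_mem_stdSimplex pX).1 x)
      ((pmfMass_mem_stdSimplex (W x)).1 y)) (Finset.mem_univ x))

theorem mean_letterMass_eval (pX : PMF A) (W : A → PMF A) (l : Fin s) (F : A → A → ℝ) :
    (mean (letterMass pX W) fun c => F c.1 (c.2 l)) =
      mean (pmfMass pX) fun x => mean (pmfMass (W x)) (F x) := by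
  rw [mean_letterMass]
  congr 1
  funext x
  exact mean_piMass_eval (pmfMass_mem_stdSimplex (W x)) l (F x)

theorem mul_sqrt_div_le {u v : ℝ} (hu : 0 ≤ u) (hv : 0 ≤ v) : v * √(u / v) ≤ √(v * u) := by
  rcases hv.eq_or_lt with h | h
  · simp [← h]
  · refine Real.le_sqrt_of_sq_le ?_
    rw [mul_pow, Real.sq_sqrt (div_nonneg hu hv)]
    exact le_of_eq (by field_simp)

open Classical in
-- Under the joint law of entry and copy, the root of output mass over channel mass has mean at most
-- the Bhattacharyya coefficient; the seeds are independent.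
theorem columnTest_miss_le (pX : PMF A) (W : A → PMF A) {B n : ℕ} (j : Fin n) (l : Fin s) :
    (mean (piMass (piMass (letterMass pX W))) fun g : Fin B → Fin n → A × (Fin s → A) =>
      if ColumnTest pX W (fun b => (g b j).1) (fun b => (g b j).2 l) then (0 : ℝ) else 1) ≤
      bhattacharyya pX W ^ B := by
  have hL := letterMass_mem_stdSimplex (s := s) pX W
  have hR := piMass_mem_stdSimplex (ι := Fin n) hL
  have h1 : (mean (letterMass pX W) fun c : A × (Fin s → A) =>
      √(outputLetter pX W (c.2 l) / pmfMass (W c.1) (c.2 l))) ≤ bhattacharyya pX W := by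
    rw [mean_letterMass_eval pX W l (fun x y => √(outputLetter pX W y / pmfMass (W x) y))]
    exact mean_mono (pmfMass_mem_stdSimplex pX) fun x _ => Finset.sum_le_sum fun y _ =>
      mul_sqrt_div_le (outputLetter_nonneg _ _ _) ((pmfMass_mem_stdSimplex (W x)).1 y)
  refine (mean_mono (piMass_mem_stdSimplex hR) (G := fun g => ∏ b,
    √(outputLetter pX W ((g b j).2 l) / pmfMass (W (g b j).1) ((g b j).2 l)))
    fun g hg => ?_).trans ?_
  · split_ifs with h
    · exact Finset.prod_nonneg fun b _ => Real.sqrt_nonneg _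
    · exact one_le_prod_sqrt_div (fun b => outputLetter_nonneg _ _ _)
        (fun b => (pos_of_letterMass_pos (pos_of_piMass_pos hL (pos_of_piMass_pos hR hg b) j)).2 l)
        (not_lt.mp h)
  · rw [mean_piMass_prod _ (fun _ (d : Fin n → A × (Fin s → A)) =>
      √(outputLetter pX W ((d j).2 l) / pmfMass (W (d j).1) ((d j).2 l))),
      Finset.prod_const, Finset.card_univ, Fintype.card_fin,
      mean_piMass_eval hL j (fun c : A × (Fin s → A) =>
        √(outputLetter pX W (c.2 l) / pmfMass (W c.1) (c.2 l)))]
    exact pow_le_pow_left₀ (mean_nonneg hL fun _ => Real.sqrt_nonneg _) h1 B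

open Classical in
-- Different columns are independent, so the inverse ratio is averaged under the product of the
-- marginals, with the same coefficient as bound.
theorem columnTest_false_alarm_le (pX : PMF A) (W : A → PMF A) {B n : ℕ} {j k : Fin n}
    (hjk : j ≠ k) (l : Fin s) :
    (mean (piMass (piMass (letterMass pX W))) fun g : Fin B → Fin n → A × (Fin s → A) =>
      if ColumnTest pX W (fun b => (g b j).1) (fun b => (g b k).2 l) then (1 : ℝ) else 0) ≤
      bhattacharyya pX W ^ B := by
  have hL := letterMass_mem_stdSimplex (s := s) pX W
  have hX := pmfMass_mem_stdSimplex pX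
  have hR := piMass_mem_stdSimplex (ι := Fin n) hL
  set F : A → A → ℝ := fun x y => √(pmfMass (W x) y / outputLetter pX W y) with hF
  have hF0 : ∀ x y, 0 ≤ F x y := fun x y => Real.sqrt_nonneg _
  have h1 : (mean (letterMass pX W) fun c : A × (Fin s → A) =>
      mean (letterMass pX W) fun c' : A × (Fin s → A) => F c.1 (c'.2 l)) ≤
      bhattacharyya pX W := by
    have h2 : ∀ x, (mean (letterMass pX W) fun c' : A × (Fin s → A) => F x (c'.2 l)) =
        ∑ y, outputLetter pX W y * F x y := by
      intro x
      rw [mean_letterMass_eval pX W l (fun _ y => F x y), mean_outputLetter]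
    simp only [h2]
    rw [mean_letterMass_eval pX W l (fun x _ => ∑ y, outputLetter pX W y * F x y)]
    simp only [mean_const (pmfMass_mem_stdSimplex _)]
    refine mean_mono hX fun x _ => Finset.sum_le_sum fun y _ => ?_
    rw [mul_comm (pmfMass (W x) y)]
    exact mul_sqrt_div_le ((pmfMass_mem_stdSimplex (W x)).1 y) (outputLetter_nonneg _ _ _)
  refine (mean_mono (piMass_mem_stdSimplex hR) (G := fun g => ∏ b, F (g b j).1 ((g b k).2 l))
    fun g hg => ?_).trans ?_
  · split_ifs with h
    · refine one_le_prod_sqrt_div (fun b => (pmfMass_mem_stdSimplex _).1 _) (fun b => ?_) h.le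
      have := pos_of_letterMass_pos (pos_of_piMass_pos hL (pos_of_piMass_pos hR hg b) k)
      exact outputLetter_pos this.1 (this.2 l)
    · exact Finset.prod_nonneg fun b _ => hF0 _ _
  · rw [mean_piMass_prod _ (fun _ (d : Fin n → A × (Fin s → A)) => F (d j).1 ((d k).2 l)),
      Finset.prod_const, Finset.card_univ, Fintype.card_fin,
      mean_piMass_eval₂ hL hjk (fun c c' : A × (Fin s → A) => F c.1 (c'.2 l))]
    exact pow_le_pow_left₀ (mean_nonneg hL fun _ => mean_nonneg hL fun _ => hF0 _ _) h1 B

open Classical in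
/-- The union bound for the errors of the column test on the seeds. -/
theorem not_separates_le (pX : PMF A) (W : A → PMF A) (B n : ℕ) :
    (mean (piMass (piMass (letterMass pX W))) fun g : Fin B → Fin n → A × (Fin s → A) =>
      if Separates (ColumnTest pX W) (fun b j => (g b j).1) (fun b j => (g b j).2) then (0 : ℝ)
        else 1) ≤ n * n * s * bhattacharyya pX W ^ B := by
  have hL := letterMass_mem_stdSimplex (s := s) pX W
  have hR := piMass_mem_stdSimplex (ι := Fin n) hL
  refine (mean_mono (piMass_mem_stdSimplex hR) (G := fun g => ∑ j, ∑ k, ∑ l,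
    if (ColumnTest pX W (fun b => (g b j).1) (fun b => (g b k).2 l) ↔ j = k) then (0 : ℝ)
      else 1) fun g _ => ?_).trans ?_
  · have h0 : ∀ j k l, (0 : ℝ) ≤ if (ColumnTest pX W (fun b => (g b j).1)
        (fun b => (g b k).2 l) ↔ j = k) then (0 : ℝ) else 1 := by
      intro j k l
      split_ifs <;> norm_num
    split_ifs with h
    · exact Finset.sum_nonneg fun j _ => Finset.sum_nonneg fun k _ =>
        Finset.sum_nonneg fun l _ => h0 j k l
    · simp only [Separates, not_forall] at h
      obtain ⟨j, k, l, h⟩ := h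
      calc (1 : ℝ) = if (ColumnTest pX W (fun b => (g b j).1)
            (fun b => (g b k).2 l) ↔ j = k) then (0 : ℝ) else 1 := (if_neg h).symm
        _ ≤ _ := (Finset.single_le_sum (fun l _ => h0 j k l) (Finset.mem_univ l))
        _ ≤ _ := (Finset.single_le_sum (fun k _ => Finset.sum_nonneg fun l _ => h0 j k l)
          (Finset.mem_univ k))
        _ ≤ _ := (Finset.single_le_sum (fun j _ => Finset.sum_nonneg fun k _ =>
          Finset.sum_nonneg fun l _ => h0 j k l) (Finset.mem_univ j))
  · simp only [mean_sum]
    calc _ ≤ ∑ _j : Fin n, ∑ _k : Fin n, ∑ _l : Fin s, bhattacharyya pX W ^ B := by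
          refine Finset.sum_le_sum fun j _ => Finset.sum_le_sum fun k _ =>
            Finset.sum_le_sum fun l _ => ?_
          -- Diagonal terms are misses, the others false alarms.
          by_cases hjk : j = k
          · subst hjk
            simpa using columnTest_miss_le pX W j l
          · simpa [hjk, ite_not] using columnTest_false_alarm_le pX W hjk l
      _ = _ := by
          simp only [Finset.sum_const, Finset.card_univ, Fintype.card_fin, nsmul_eq_mul]
          ring

end ColumnTest

/-! ### Achievability: row matching by a likelihood threshold -/

section Achievability

variable {A : Type*} [Fintype A] {s : ℕ}

/-- Averaged over `S` as well, the log-ratio of a correct pair is an i.i.d. sum whose mean per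
column exceeds `γ`; `θ` is the one-column exponential moment. -/
theorem exists_rowRatio_lower_tail (pX : PMF A) (pS : PMF (Fin (s + 1))) (W : A → PMF A)
    {γ : ℝ} (hγ : γ < repetitionInfo pX pS W * Real.log 2) :
    ∃ θ : ℝ, 0 ≤ θ ∧ θ < 1 ∧ ∀ n : ℕ,
      (mean (piMass (pmfMass pS)) fun S : Fin n → Fin (s + 1) =>
        mean (piMass (letterMass pX W)) fun d : Fin n → A × (Fin s → A) =>
          if rowRatio pX W S (fun j => (d j).1) (fun j => truncate (S j) (d j).2) <
            Real.exp (n * γ) then (1 : ℝ) else 0) ≤ θ ^ n := by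
  have hS := pmfMass_mem_stdSimplex pS
  have hL := letterMass_mem_stdSimplex (s := s) pX W
  set p : Fin (s + 1) × (A × (Fin s → A)) → ℝ := fun a => pmfMass pS a.1 * letterMass pX W a.2
    with hp
  have hpm : ∀ F : Fin (s + 1) × (A × (Fin s → A)) → ℝ, mean p F =
      mean (pmfMass pS) fun r => mean (letterMass pX W) fun c => F (r, c) := by
    intro F
    simp only [mean, hp, Fintype.sum_prod_type, Finset.mul_sum, mul_assoc]
  have hps : p ∈ stdSimplex ℝ (Fin (s + 1) × (A × (Fin s → A))) := by
    refine ⟨fun a => mul_nonneg (hS.1 _) (hL.1 _), ?_⟩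
    have := hpm fun _ => 1
    simp only [mean_const hS, mean_const hL] at this
    simpa [mean] using this
  rw [repetitionInfo_mul_log_two, ← hpm fun a =>
    Real.log (likelihoodRatio pX W a.2.1 (truncate a.1 a.2.2))] at hγ
  obtain ⟨t, ht, hlt⟩ := exists_exponential_moment_lt_one hps hγ
  rw [hpm] at hlt
  refine ⟨_, mean_nonneg hS fun r => mean_nonneg hL fun c => (Real.exp_pos _).le, hlt, ?_⟩
  intro n
  refine (mean_mono (piMass_mem_stdSimplex hS) fun S _ => mean_mono (piMass_mem_stdSimplex hL)
    (G := fun d => ∏ j, Real.exp (t * (γ -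
      Real.log (likelihoodRatio pX W (d j).1 (truncate (S j) (d j).2))))) fun d hd => ?_).trans ?_
  · split_ifs with h
    · have hpos : ∀ j, 0 < likelihoodRatio pX W (d j).1 (truncate (S j) (d j).2) :=
        fun j => likelihoodRatio_truncate_pos (pos_of_piMass_pos hL hd j) _
      rw [← Real.exp_sum, ← Finset.mul_sum, Finset.sum_sub_distrib,
        ← Real.log_prod fun j _ => (hpos j).ne']
      refine Real.one_le_exp (mul_nonneg ht.le (sub_nonneg.mpr ?_))
      simp only [Finset.sum_const, Finset.card_univ, Fintype.card_fin, nsmul_eq_mul]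
      rw [Real.log_le_iff_le_exp (Finset.prod_pos fun j _ => hpos j)]
      exact h.le
    · exact Finset.prod_nonneg fun j _ => (Real.exp_pos _).le
  · have h1 : ∀ S : Fin n → Fin (s + 1), (mean (piMass (letterMass pX W)) fun d =>
        ∏ j, Real.exp (t * (γ -
          Real.log (likelihoodRatio pX W (d j).1 (truncate (S j) (d j).2))))) =
        ∏ j, mean (letterMass pX W) fun c => Real.exp (t * (γ -
          Real.log (likelihoodRatio pX W c.1 (truncate (S j) c.2)))) := fun S =>
      mean_piMass_prod _ (fun j (c : A × (Fin s → A)) => Real.exp (t * (γ -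
          Real.log (likelihoodRatio pX W c.1 (truncate (S j) c.2)))))
    simp only [h1]
    rw [mean_piMass_prod _ (fun _ r => mean (letterMass pX W) fun c => Real.exp (t * (γ -
          Real.log (likelihoodRatio pX W c.1 (truncate r c.2))))), Finset.prod_const,
      Finset.card_univ, Fintype.card_fin]

/-- Markov's inequality: averaging the ratio over an independent row `x`, for a fixed labeled row,
gives at most 1. -/
theorem rowRatio_upper_tail (pX : PMF A) (W : A → PMF A) {m n : ℕ} (S : Fin n → Fin (s + 1))
    {J i : Fin m} (hJ : J ≠ i) (γ : ℝ) :
    (mean (piMass (piMass (letterMass pX W))) fun c : Fin m → Fin n → A × (Fin s → A) =>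
      if Real.exp (n * γ) ≤ rowRatio pX W S (fun j => (c J j).1)
        (fun j => truncate (S j) (c i j).2) then (1 : ℝ) else 0) ≤ Real.exp (-(n * γ)) := by
  have hX := pmfMass_mem_stdSimplex pX
  have hL := letterMass_mem_stdSimplex (s := s) pX W
  have hR := piMass_mem_stdSimplex (ι := Fin n) hL
  have h0 : ∀ (r : Fin (s + 1)) (c c' : A × (Fin s → A)),
      0 ≤ likelihoodRatio pX W c.1 (truncate r c'.2) :=
    fun r c c' => likelihoodRatio_nonneg _ _ _ _
  have hle : ∀ r : Fin (s + 1), (mean (letterMass pX W) fun c' : A × (Fin s → A) =>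
      mean (letterMass pX W) fun c : A × (Fin s → A) =>
        likelihoodRatio pX W c.1 (truncate r c'.2)) ≤ 1 := by
    intro r
    refine (mean_mono hL fun c' _ => ?_).trans_eq (mean_const hL 1)
    rw [mean_letterMass]
    simp only [mean_const (piMass_mem_stdSimplex (pmfMass_mem_stdSimplex _)), likelihoodRatio,
      div_eq_mul_inv]
    rw [mean_mul_const]
    -- The output mass over itself: 1, or 0 for an impossible word.
    exact mul_inv_le_one
  refine (mean_mono (piMass_mem_stdSimplex hR) (G := fun c => Real.exp (-(n * γ)) *
    rowRatio pX W S (fun j => (c J j).1) (fun j => truncate (S j) (c i j).2))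
    fun c _ => ?_).trans ?_
  · split_ifs with h
    · rw [Real.exp_neg, inv_mul_eq_div, one_le_div (Real.exp_pos _)]
      exact h
    · exact mul_nonneg (Real.exp_pos _).le (Finset.prod_nonneg fun j _ => h0 _ _ _)
  · rw [mean_const_mul]
    refine mul_le_of_le_one_right (Real.exp_pos _).le ?_
    rw [mean_piMass_eval₂ hR hJ.symm (fun d' d : Fin n → A × (Fin s → A) =>
      rowRatio pX W S (fun j => (d j).1) (fun j => truncate (S j) (d' j).2))]
    have h1 : ∀ d' : Fin n → A × (Fin s → A),
        (mean (piMass (letterMass pX W)) fun d : Fin n → A × (Fin s → A) =>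
          rowRatio pX W S (fun j => (d j).1) (fun j => truncate (S j) (d' j).2)) =
        ∏ j, mean (letterMass pX W) fun c : A × (Fin s → A) =>
          likelihoodRatio pX W c.1 (truncate (S j) (d' j).2) := fun d' =>
      mean_piMass_prod _ (fun j (c : A × (Fin s → A)) =>
        likelihoodRatio pX W c.1 (truncate (S j) (d' j).2))
    simp only [h1]
    rw [mean_piMass_prod _ (fun j (c' : A × (Fin s → A)) =>
      mean (letterMass pX W) fun c : A × (Fin s → A) =>
        likelihoodRatio pX W c.1 (truncate (S j) c'.2))]
    exact Finset.prod_le_one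
      (fun j _ => mean_nonneg hL fun c' => mean_nonneg hL fun c => h0 _ _ _) fun j _ => hle _

/-- The labeled row `y` has a large likelihood ratio with the row `x` for the pattern `S`. -/
def Accepts (pX : PMF A) (W : A → PMF A) (γ : ℝ) {n : ℕ} (S : Fin n → Fin (s + 1))
    (x : Fin n → A) (y : List A) : Prop :=
  ∃ z : Fin n → Fin s → A, repeatRow S z = y ∧
    Real.exp (n * γ) ≤ rowRatio pX W S x fun j => truncate (S j) (z j)

/-- The pattern `S` explains the seeds in agreement with the column test. -/
def Explains (pX : PMF A) (W : A → PMF A) {B n : ℕ} (S : Fin n → Fin (s + 1))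
    (xG : Fin B → Fin n → A) (yG : Fin B → List A) : Prop :=
  ∃ z : Fin B → Fin n → Fin s → A, Separates (ColumnTest pX W) xG z ∧
    ∀ b, repeatRow S (z b) = yG b

open Classical in
/-- The matching map that reads the repetition pattern off the seeds and then applies a
likelihood ratio test to the pairs of rows. -/
def thresholdMatching (s : ℕ) (pX : PMF A) (W : A → PMF A) (γ : ℝ) (m B n : ℕ) :
    MatchingMap A m B n := fun x y xG yG J =>
  if h : ∃ i, ∃ S : Fin n → Fin (s + 1), Explains pX W S xG yG ∧ Accepts pX W γ S (x J) (y i)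
  -- The default is never reached when the column test is right on the seeds and the true row
  -- passes.
  then h.choose else J

theorem accepts_repeatRow_iff {pX : PMF A} {W : A → PMF A} {γ : ℝ} {n : ℕ}
    {S : Fin n → Fin (s + 1)} {x : Fin n → A} {z : Fin n → Fin s → A} :
    Accepts pX W γ S x (repeatRow S z) ↔
      Real.exp (n * γ) ≤ rowRatio pX W S x fun j => truncate (S j) (z j) := by
  refine ⟨?_, fun h => ⟨z, rfl, h⟩⟩
  rintro ⟨z', h, h'⟩
  simpa only [rowRatio, truncate_eq_of_repeatRow_eq h] using h'

/-- Only the true pattern explains correctly separated seeds, so `Θ J` is the only index that can be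
chosen. -/
theorem thresholdMatching_eq {pX : PMF A} {W : A → PMF A} {γ : ℝ} {m B n : ℕ} (hB : 0 < B)
    {S : Fin n → Fin (s + 1)} {Θ : Equiv.Perm (Fin m)} {x : Fin m → Fin n → A}
    {z : Fin m → Fin n → Fin s → A} {xG : Fin B → Fin n → A} {zG : Fin B → Fin n → Fin s → A}
    {J : Fin m} (hsep : Separates (ColumnTest pX W) xG zG)
    (hJ : Real.exp (n * γ) ≤ rowRatio pX W S (x J) fun j => truncate (S j) (z J j))
    (hne : ∀ i, i ≠ J →
      rowRatio pX W S (x J) (fun j => truncate (S j) (z i j)) < Real.exp (n * γ)) :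
    thresholdMatching s pX W γ m B n x (fun i => repeatRow S (z (Θ.symm i))) xG
      (fun b => repeatRow S (zG b)) J = Θ J := by
  have hex : ∃ i, ∃ S' : Fin n → Fin (s + 1),
      Explains pX W S' xG (fun b => repeatRow S (zG b)) ∧
        Accepts pX W γ S' (x J) (repeatRow S (z (Θ.symm i))) := by
    refine ⟨Θ J, S, ⟨zG, hsep, fun b => rfl⟩, ?_⟩
    rw [Equiv.symm_apply_apply]
    exact accepts_repeatRow_iff.mpr hJ
  rw [thresholdMatching, dif_pos hex]
  obtain ⟨S', ⟨zG', hsep', heq⟩, hacc⟩ := hex.choose_spec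
  have hS : S' = S := hsep'.pattern_eq hB hsep heq
  subst hS
  by_contra hi
  exact absurd (accepts_repeatRow_iff.mp hacc)
    (not_le.mpr (hne _ fun h => hi ((Equiv.symm_apply_eq Θ).mp h)))

theorem errorProb_thresholdMatching_le (pX : PMF A) (pS : PMF (Fin (s + 1))) (W : A → PMF A)
    {γ θ : ℝ} {m B n : ℕ} (hm : 0 < m) (hB : 0 < B)
    (hθ : (mean (piMass (pmfMass pS)) fun S : Fin n → Fin (s + 1) =>
        mean (piMass (letterMass pX W)) fun d : Fin n → A × (Fin s → A) =>
          if rowRatio pX W S (fun j => (d j).1) (fun j => truncate (S j) (d j).2) <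
            Real.exp (n * γ) then (1 : ℝ) else 0) ≤ θ ^ n) :
    errorProb pX pS W (thresholdMatching s pX W γ m B n) ≤
      n * n * s * bhattacharyya pX W ^ B + θ ^ n + m * Real.exp (-(n * γ)) := by
  classical
  have : NeZero m := ⟨hm.ne'⟩
  have hS := piMass_mem_stdSimplex (ι := Fin n) (pmfMass_mem_stdSimplex pS)
  have hL := letterMass_mem_stdSimplex (s := s) pX W
  have hR := piMass_mem_stdSimplex (ι := Fin n) hL
  have hG := piMass_mem_stdSimplex (ι := Fin B) hR
  have hC := piMass_mem_stdSimplex (ι := Fin m) hR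
  have hP := uniform_mem_stdSimplex (α := Equiv.Perm (Fin m))
  have hU := uniform_mem_stdSimplex (α := Fin m)
  rw [errorProb_eq_mean]
  -- An error needs a wrong column test, a rejected true row or an accepted false row.
  have hpt : ∀ (S : Fin n → Fin (s + 1)) (g : Fin B → Fin n → A × (Fin s → A))
      (Θ : Equiv.Perm (Fin m)) (c : Fin m → Fin n → A × (Fin s → A)) (J : Fin m),
      (if Θ J ≠ thresholdMatching s pX W γ m B n (fun i j => (c i j).1)
          (fun i => repeatRow S fun j => (c (Θ.symm i) j).2) (fun b j => (g b j).1)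
          (fun b => repeatRow S fun j => (g b j).2) J then (1 : ℝ) else 0) ≤
      (if Separates (ColumnTest pX W) (fun b j => (g b j).1) (fun b j => (g b j).2) then (0 : ℝ)
        else 1) +
      (if rowRatio pX W S (fun j => (c J j).1) (fun j => truncate (S j) (c J j).2) <
            Real.exp (n * γ) then (1 : ℝ) else 0) +
      ∑ i, if i = J then 0 else if Real.exp (n * γ) ≤ rowRatio pX W S (fun j => (c J j).1)
        (fun j => truncate (S j) (c i j).2) then (1 : ℝ) else 0 := by
    intro S g Θ c J
    have h0 : ∀ i, (0 : ℝ) ≤ if i = J then 0 else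
        if Real.exp (n * γ) ≤ rowRatio pX W S (fun j => (c J j).1)
          (fun j => truncate (S j) (c i j).2) then (1 : ℝ) else 0 := by
      intro i
      split_ifs <;> norm_num
    have h0' := Finset.sum_nonneg fun i (_ : i ∈ Finset.univ) => h0 i
    by_cases hsep : Separates (ColumnTest pX W) (fun b j => (g b j).1) (fun b j => (g b j).2)
    swap
    · rw [if_neg hsep]
      refine le_add_of_le_of_nonneg (le_add_of_le_of_nonneg ?_ ?_) h0' <;>
        split_ifs <;> norm_num
    by_cases hJ : rowRatio pX W S (fun j => (c J j).1) (fun j => truncate (S j) (c J j).2) <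
        Real.exp (n * γ)
    · rw [if_pos hsep, if_pos hJ, zero_add]
      refine le_add_of_le_of_nonneg ?_ h0'
      split_ifs <;> norm_num
    rw [if_pos hsep, if_neg hJ, zero_add, zero_add]
    by_cases hne : ∀ i, i ≠ J → rowRatio pX W S (fun j => (c J j).1)
        (fun j => truncate (S j) (c i j).2) < Real.exp (n * γ)
    · rw [if_neg]
      · exact h0'
      · exact not_not.mpr (thresholdMatching_eq hB (Θ := Θ) (x := fun i j => (c i j).1)
          (z := fun i j => (c i j).2) (zG := fun b j => (g b j).2) hsep (not_lt.mp hJ) hne).symm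
    · push Not at hne
      obtain ⟨i, hi, hle⟩ := hne
      refine le_trans ?_ (Finset.single_le_sum (fun i _ => h0 i) (Finset.mem_univ i))
      rw [if_neg hi, if_pos hle]
      split_ifs <;> norm_num
  refine (mean_mono hS fun S _ => mean_mono hG fun g _ => mean_mono hP fun Θ _ =>
    mean_mono hC fun c _ => mean_mono hU fun J _ => hpt S g Θ c J).trans ?_
  simp only [mean_add, mean_const hS, mean_const hP, mean_const hU, mean_const hC,
    mean_const hG]
  refine add_le_add (add_le_add (not_separates_le pX W B n) ?_) ?_
  · have h1 : ∀ S : Fin n → Fin (s + 1), (mean (piMass (piMass (letterMass pX W)))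
        fun c : Fin m → Fin n → A × (Fin s → A) =>
          mean (fun _ => 1 / (Fintype.card (Fin m) : ℝ)) fun J : Fin m =>
            if rowRatio pX W S (fun j => (c J j).1) (fun j => truncate (S j) (c J j).2) <
              Real.exp (n * γ) then (1 : ℝ) else 0) =
        mean (piMass (letterMass pX W)) fun d : Fin n → A × (Fin s → A) =>
          if rowRatio pX W S (fun j => (d j).1) (fun j => truncate (S j) (d j).2) <
            Real.exp (n * γ) then (1 : ℝ) else 0 := by
      intro S
      rw [mean_comm]
      refine (congrArg _ (funext fun J => ?_)).trans (mean_const hU _)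
      exact mean_piMass_eval hR J (fun d : Fin n → A × (Fin s → A) =>
        if rowRatio pX W S (fun j => (d j).1) (fun j => truncate (S j) (d j).2) <
          Real.exp (n * γ) then (1 : ℝ) else 0)
    simp only [h1]
    exact hθ
  · refine (mean_mono hS fun S _ => ?_).trans_eq (mean_const hS _)
    rw [mean_comm]
    refine (mean_mono hU fun J _ => ?_).trans_eq (mean_const hU _)
    rw [mean_sum]
    calc _ ≤ ∑ _i : Fin m, Real.exp (-(n * γ)) := by
          refine Finset.sum_le_sum fun i _ => ?_
          by_cases hi : i = J
          · simp only [hi, if_true, mean_const hC]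
            exact (Real.exp_pos _).le
          · simp only [hi, if_false]
            exact rowRatio_upper_tail pX W S (Ne.symm hi) γ
      _ = _ := by simp

theorem achievability (pX : PMF A) (pS : PMF (Fin (s + 1))) (W : A → PMF A) {d R : ℝ}
    (hd : 1 ≤ d) (hR : R < repetitionInfo pX pS W) {m B : ℕ → ℕ} (hm : HasGrowthRate m R)
    (hB : HasSeedOrder B d) :
    ∃ φ : ∀ n, MatchingMap A (m n) (B n) n, Successful pX pS W m B φ := by
  have hlog : (0 : ℝ) < Real.log 2 := Real.log_pos one_lt_two
  -- Growth rates are nonnegative since `1 ≤ m n`; hence the information is positive and the column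
  -- test works.
  have hR0 : 0 ≤ R := ge_of_tendsto' hm.2 fun n =>
    div_nonneg (Real.logb_nonneg one_lt_two (Nat.one_le_cast.mpr (hm.1 n))) n.cast_nonneg
  obtain ⟨γ, hγR, hγ⟩ := exists_between (mul_lt_mul_of_pos_right hR hlog)
  -- The gap below `γ` absorbs the fluctuation of `m n` around its growth rate.
  obtain ⟨γ', hγR', hγ'⟩ := exists_between hγR
  obtain ⟨θ, hθ0, hθ1, hθ⟩ := exists_rowRatio_lower_tail pX pS W hγ
  have hρ := bhattacharyya_lt_one pX pS W (hR0.trans_lt hR)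
  obtain ⟨C, hC, hBC⟩ := hB.2.exists_pos
  rw [IsBigOWith] at hBC
  -- Here `1 ≤ d` is used: the seeds grow at least linearly, so `ρ ^ B` beats `n ^ 2`.
  have hBn : ∀ᶠ n : ℕ in atTop, C⁻¹ * n ≤ B n := by
    filter_upwards [hBC, eventually_ge_atTop 1] with n h hn
    have hn1 : (1 : ℝ) ≤ n := Nat.one_le_cast.mpr hn
    rw [Real.norm_of_nonneg (by positivity), Real.norm_of_nonneg (by positivity)] at h
    rw [inv_mul_le_iff₀ hC]
    exact (Real.self_le_rpow_of_one_le hn1 hd).trans h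
  have hmn : ∀ᶠ n : ℕ in atTop, (m n : ℝ) ≤ Real.exp (n * γ') := by
    have h := hm.2.eventually_lt_const ((lt_div_iff₀ hlog).mpr hγR')
    filter_upwards [h, eventually_gt_atTop 0] with n h hn
    have hn0 : (0 : ℝ) < n := Nat.cast_pos.mpr hn
    rw [← Real.log_le_iff_le_exp (Nat.cast_pos.mpr (hm.1 n))]
    rw [Real.logb, div_right_comm, div_lt_div_iff_of_pos_right hlog, div_lt_iff₀ hn0] at h
    linarith
  -- The maximum ensures a positive base for the real powers.
  set ρ : ℝ := max (bhattacharyya pX W) (1 / 2) with hρdef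
  have hρ0 : 0 < ρ := lt_max_of_lt_right (by norm_num)
  have hρ1 : ρ < 1 := max_lt hρ (by norm_num)
  have hr1 : ρ ^ C⁻¹ < 1 := Real.rpow_lt_one hρ0.le hρ1 (inv_pos.mpr hC)
  have hr0 : 0 ≤ ρ ^ C⁻¹ := Real.rpow_nonneg hρ0.le _
  have he1 : Real.exp (γ' - γ) < 1 := by
    rw [Real.exp_lt_one_iff]
    linarith
  refine ⟨fun n => thresholdMatching s pX W γ (m n) (B n) n, ?_⟩
  have hlim : Tendsto (fun n : ℕ => (s : ℝ) * ((n : ℝ) ^ 2 * (ρ ^ C⁻¹) ^ n) + θ ^ n +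
      Real.exp (γ' - γ) ^ n) atTop (𝓝 (s * 0 + 0 + 0)) :=
    (((tendsto_pow_const_mul_const_pow_of_abs_lt_one 2 (by rwa [abs_of_nonneg hr0])).const_mul
      _).add (tendsto_pow_atTop_nhds_zero_of_lt_one hθ0 hθ1)).add
      (tendsto_pow_atTop_nhds_zero_of_lt_one (Real.exp_pos _).le he1)
  rw [mul_zero, zero_add, zero_add] at hlim
  refine squeeze_zero' (Eventually.of_forall fun n => ?_) ?_ hlim
  · have hL := letterMass_mem_stdSimplex (s := s) pX W
    have : NeZero (m n) := ⟨(hm.1 n).ne'⟩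
    rw [errorProb_eq_mean]
    refine mean_nonneg (piMass_mem_stdSimplex (pmfMass_mem_stdSimplex pS)) fun S =>
      mean_nonneg (piMass_mem_stdSimplex (piMass_mem_stdSimplex hL)) fun g =>
      mean_nonneg uniform_mem_stdSimplex fun Θ =>
      mean_nonneg (piMass_mem_stdSimplex (piMass_mem_stdSimplex hL)) fun c =>
      mean_nonneg uniform_mem_stdSimplex fun J => ?_
    split_ifs <;> norm_num
  · filter_upwards [hBn, hmn, eventually_gt_atTop 0] with n h1 h2 hn
    have hn0 : (0 : ℝ) < n := Nat.cast_pos.mpr hn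
    have hB0 : 0 < B n := Nat.cast_pos.mp ((mul_pos (inv_pos.mpr hC) hn0).trans_le h1)
    refine (errorProb_thresholdMatching_le pX pS W (hm.1 n) hB0 (hθ n)).trans ?_
    refine add_le_add (add_le_add ?_ le_rfl) ?_
    · have h3 : bhattacharyya pX W ^ B n ≤ (ρ ^ C⁻¹) ^ n := by
        calc bhattacharyya pX W ^ B n ≤ ρ ^ B n :=
              pow_le_pow_left₀ (bhattacharyya_nonneg pX W) (le_max_left _ _) _
          _ = ρ ^ (B n : ℝ) := (Real.rpow_natCast _ _).symm
          _ ≤ ρ ^ (C⁻¹ * n) := Real.rpow_le_rpow_of_exponent_ge hρ0 hρ1.le h1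
          _ = (ρ ^ C⁻¹) ^ n := by rw [Real.rpow_mul hρ0.le, Real.rpow_natCast]
      calc _ ≤ (n : ℝ) * n * s * (ρ ^ C⁻¹) ^ n := mul_le_mul_of_nonneg_left h3 (by positivity)
        _ = _ := by ring
    · calc _ ≤ Real.exp (n * γ') * Real.exp (-(n * γ)) :=
            mul_le_mul_of_nonneg_right h2 (Real.exp_pos _).le
        _ = _ := by
          rw [← Real.exp_add, ← Real.exp_nat_mul]
          congr 1
          ring

theorem exists_hasSeedOrder {d : ℝ} (hd : 0 ≤ d) : ∃ B : ℕ → ℕ, HasSeedOrder B d := by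
  refine ⟨fun n => ⌈(n : ℝ) ^ d⌉₊, ?_, ?_⟩
  · refine IsBigO.of_bound 2 ?_
    filter_upwards [eventually_ge_atTop 1] with n hn
    have h1 : (1 : ℝ) ≤ (n : ℝ) ^ d := Real.one_le_rpow (Nat.one_le_cast.mpr hn) hd
    rw [Real.norm_of_nonneg (by positivity), Real.norm_of_nonneg (by positivity)]
    linarith [(Nat.ceil_lt_add_one (zero_le_one.trans h1)).le]
  · refine IsBigO.of_bound 1 (Eventually.of_forall fun n => ?_)
    rw [Real.norm_of_nonneg (by positivity), Real.norm_of_nonneg (by positivity), one_mul]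
    exact Nat.le_ceil _

theorem exists_hasGrowthRate {R : ℝ} (hR : 0 ≤ R) : ∃ m : ℕ → ℕ, HasGrowthRate m R := by
  have h1 : ∀ n : ℕ, (1 : ℝ) ≤ 2 ^ (n * R) := fun n =>
    Real.one_le_rpow one_le_two (by positivity)
  have hpos : ∀ n : ℕ, 0 < ⌈(2 : ℝ) ^ (n * R)⌉₊ := fun n =>
    Nat.ceil_pos.mpr (zero_lt_one.trans_le (h1 n))
  refine ⟨fun n => ⌈(2 : ℝ) ^ (n * R)⌉₊, hpos, ?_⟩
  have hlim : Tendsto (fun n : ℕ => R + 1 / (n : ℝ)) atTop (𝓝 (R + 0)) :=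
    tendsto_const_nhds.add tendsto_one_div_atTop_nhds_zero_nat
  rw [add_zero] at hlim
  refine tendsto_of_tendsto_of_tendsto_of_le_of_le' tendsto_const_nhds hlim ?_ ?_
  · filter_upwards [eventually_gt_atTop 0] with n hn
    have hn0 : (0 : ℝ) < n := Nat.cast_pos.mpr hn
    rw [le_div_iff₀ hn0, Real.le_logb_iff_rpow_le one_lt_two (Nat.cast_pos.mpr (hpos n)),
      mul_comm]
    exact Nat.le_ceil _
  · filter_upwards [eventually_gt_atTop 0] with n hn
    have hn0 : (0 : ℝ) < n := Nat.cast_pos.mpr hn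
    rw [div_le_iff₀ hn0, Real.logb_le_iff_le_rpow one_lt_two (Nat.cast_pos.mpr (hpos n))]
    have : (R + 1 / n) * n = n * R + 1 := by field_simp
    -- Rounding up at most doubles a number that is at least 1, adding at most `1 / n` to the rate.
    rw [this, Real.rpow_add two_pos, Real.rpow_one]
    linarith [(Nat.ceil_lt_add_one (zero_le_one.trans (h1 n))).le, h1 n]

theorem achievable_zero (pX : PMF A) (pS : PMF (Fin (s + 1))) (W : A → PMF A) {d : ℝ}
    (hd : 0 ≤ d) : Achievable pX pS W d 0 := by
  obtain ⟨B, hB⟩ := exists_hasSeedOrder hd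
  refine ⟨fun _ => 1, B, ⟨fun _ => one_pos, by simp⟩, hB, fun n _ _ _ _ J => J, ?_⟩
  simp [Successful, errorProb, Subsingleton.elim _ (0 : Fin 1)]

end Achievability

/-! ### The capacity formula -/

theorem isMatchingCapacity_repetitionInfo {A : Type*} [Fintype A] {s : ℕ} (pX : PMF A)
    (pS : PMF (Fin (s + 1))) (W : A → PMF A) {d : ℝ} (hd : 1 ≤ d) :
    IsMatchingCapacity pX pS W d (repetitionInfo pX pS W) := by
  have hd0 : 0 ≤ d := zero_le_one.trans hd
  refine ⟨?_, fun b hb => ?_⟩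
  · rintro R ⟨m, B, hm, -, φ, hφ⟩
    exact converse pX pS W R m B hm φ hφ
  · have hb0 : 0 ≤ b := hb (achievable_zero pX pS W hd0)
    refine le_of_forall_lt_imp_le_of_dense fun R hR => ?_
    -- No row sizes have a negative growth rate; such `R` are covered by the rate 0, achieved with a
    -- single row.
    rcases lt_or_ge R 0 with h | h
    · exact h.le.trans hb0
    · obtain ⟨m, hm⟩ := exists_hasGrowthRate h
      obtain ⟨B, hB⟩ := exists_hasSeedOrder hd0
      exact hb ⟨m, B, hm, hB, achievability pX pS W hd hR hm hB⟩

end DatabaseMatching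

end

/-- The matching capacity under noisy column repetitions.  The first part is the capacity formula
for seed orders `d ≥ 1`; the second says that each rate below capacity is achieved whatever the
row numbers of that growth rate and the seed sizes of order `d` are; the third is the
converse, for arbitrary seed sizes (hence for every seed order). -/
theorem theorem1 {A : Type*} [Fintype A] {s : ℕ}
    (pX : PMF A) (pS : PMF (Fin (s + 1))) (W : A → PMF A) :
    (∀ d : ℝ, 1 ≤ d →
      DatabaseMatching.IsMatchingCapacity pX pS W d
        (DatabaseMatching.repetitionInfo pX pS W)) ∧
    (∀ d : ℝ, 1 ≤ d → ∀ R : ℝ, R < DatabaseMatching.repetitionInfo pX pS W →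
      ∀ m B : ℕ → ℕ, DatabaseMatching.HasGrowthRate m R → DatabaseMatching.HasSeedOrder B d →
        ∃ φ : ∀ n, DatabaseMatching.MatchingMap A (m n) (B n) n,
          DatabaseMatching.Successful pX pS W m B φ) ∧
    (∀ (R : ℝ) (m B : ℕ → ℕ), DatabaseMatching.HasGrowthRate m R →
      ∀ φ : ∀ n, DatabaseMatching.MatchingMap A (m n) (B n) n,
        DatabaseMatching.Successful pX pS W m B φ →
          R ≤ DatabaseMatching.repetitionInfo pX pS W) := by
  exact ⟨fun d hd => DatabaseMatching.isMatchingCapacity_repetitionInfo pX pS W hd,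
    fun d hd R hR m B hm hB => DatabaseMatching.achievability pX pS W hd hR hm hB,
    fun R m B hm φ hφ => DatabaseMatching.converse pX pS W R m B hm φ hφ⟩
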